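/- For complex $\mu,z$ let $D_\mu(z)$ be the parabolic cylinder function, the entire function of $z$ given by $$D_\mu(z)=2^{\mu/2}e^{-z^2/4}\left[\frac{\sqrt{\pi}}{\Gamma\left(\frac{1-\mu}{2}\right)}\,M\!\left(-\frac{\mu}{2},\frac12,\frac{z^2}{2}\right)-\frac{\sqrt{2\pi}\,z}{\Gamma\left(-\frac{\mu}{2}\right)}\,M\!\left(\frac{1-\mu}{2},\frac32,\frac{z^2}{2}\right)\right],$$ where $M(\alpha,\gamma,z)=\sum_{n\ge 0}\frac{(\alpha)_n}{(\gamma)_n}\frac{z^n}{n!}$ is Kummer's function and $1/\Gamma$ is $0$ at the poles of $\Gamma$. Let $\nu,a,b\in\mathbb{C}$ with $\operatorname{Re}\nu>0$ and $\operatorname{Re}(a+b)>0$. Then the integral below converges absolutely and $$\int_0^\infty t^{\nu/2-1}(1+t)^{-(\nu+1)/2}e^{-at}e^{-b\sqrt{t(t+1)}}\,dt=2e^{a/2}\,\Gamma(\nu)\,D_{-\nu}\!\left(\sqrt{a+\sqrt{a^2-b^2}}\right)D_{-\nu}\!\left(\sqrt{a-\sqrt{a^2-b^2}}\right),$$ where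 $\sqrt{a^2-b^2}$ is either square root (the same one in both places) and the two outer square roots $x=\sqrt{a+\sqrt{a^2-b^2}}$ and $y=\sqrt{a-\sqrt{a^2-b^2}}$ are taken on the branch with $xy=b$ and $\operatorname{Re}(x+y)>0$; such $x,y$ exist for all these $a,b$, and the identity holds for every such choice. If $b$ is real and $b\ge 0$, the identity also holds with all square roots principal. -/

import Mathlib

/-- Kummer's confluent hypergeometric function `M(α, γ, z) = ∑ₙ (α)ₙ zⁿ / ((γ)ₙ n!)`, for `γ` not a
nonpositive integer, from Mathlib's regularized hypergeometric series
`∑ₙ (α)ₙ zⁿ / (Γ(γ + n) n!)`. -/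
noncomputable def kummerM (α γ z : ℂ) : ℂ :=
  Complex.Gamma γ * Complex.regularizedHGFun {α} {γ} z

/-- The parabolic cylinder function `D_μ(z)` as an entire function of `z`. It is
`2^((2μ+1)/4) z^(-1/2) W_{(2μ+1)/4, -1/4}(z²/2)` for `Re z > 0`, with Whittaker's function `W` written
through Kummer's function, and its analytic continuation elsewhere. Where `Γ` has a pole,
the quotient by it is `0`, in Lean too. -/
noncomputable def parabolicCylinderD (μ z : ℂ) : ℂ :=
  (2 : ℂ) ^ (μ / 2) * Complex.exp (-z ^ 2 / 4) *
    ((Real.sqrt Real.pi : ℂ) / Complex.Gamma ((1 - μ) / 2) * kummerM (-μ / 2) (1 / 2) (z ^ 2 / 2)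
      - (Real.sqrt (2 * Real.pi) : ℂ) * z / Complex.Gamma (-μ / 2) *
        kummerM ((1 - μ) / 2) (3 / 2) (z ^ 2 / 2))

/-- The principal square root (real part nonnegative). -/
noncomputable def principalSqrt (z : ℂ) : ℂ := z ^ (1 / 2 : ℂ)

/-- The integrand `t^(ν/2-1) (1+t)^(-(ν+1)/2) e^(-at) e^(-b√(t(t+1)))`. -/
noncomputable def laplaceIntegrand (ν a b : ℂ) (t : ℝ) : ℂ :=
  (t : ℂ) ^ (ν / 2 - 1) * (1 + (t : ℂ)) ^ (-(ν + 1) / 2) * Complex.exp (-a * t) *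
    Complex.exp (-b * (Real.sqrt (t * (t + 1)) : ℂ))

/-- `x` and `y` are values of `√(a + √(a² - b²))` and `√(a - √(a² - b²))`, with the same value of the
inner root, on the branch where `xy = b` and `Re (x + y) > 0`. -/
def IsRootPair (a b x y : ℂ) : Prop :=
  (∃ r : ℂ, r ^ 2 = a ^ 2 - b ^ 2 ∧ x ^ 2 = a + r ∧ y ^ 2 = a - r) ∧ x * y = b ∧ 0 < (x + y).re

open MeasureTheory Set Filter Topology

/-! Write `U(x)` for `parabolicIntegral ν x`. With `x² + y² = 2a` and `xy = b` the Laplace integrand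
becomes the weight `t^(ν/2-1) (1+t)^(-(ν+1)/2)` times `e^(-(x²+y²)t/2 - xy√(t(t+1)))`. Fix `y` and
let `F(x)` be its integral. Since `(x+y)² = 2(a+b)`, the conditions on `a`, `b` and on the branch
say exactly that `x + y` lies in the sector `|arg| < π/4`, where `F` is holomorphic.

Both `F` and `U` solve `f'' = x f' + ν f`: for `U` by integration by parts
(`parabolicIntegral_add_two`), for `F` because a combination of moments is a total derivative
(`weightedLaplace_relation`). Hence `(F U' - F' U) e^(-x²/2)` is constant. Along `x + τ`, `τ → +∞`,
the functions `F`, `F'`, `U`, `U'` grow at most exponentially while the Gaussian factor decays, so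
the constant is zero (`wronskian_eq_zero`) and `F` is proportional to `U`.

The factor is read off at infinity: `τ^ν U(x+τ) → Γ(ν)` and `τ^ν F(x+τ) → 2 U(y)`. So `Γ(ν) F(x) = 2
U(x) U(y)` (`Gamma_mul_weightedLaplace`). Comparing power series gives `Γ(ν) D_{-ν}(x) = e^(-x²/4)
U(x)` (`Gamma_mul_parabolicCylinderD_neg`), and the two Gaussian factors combine to `e^(-a/2)`. -/

/-! ### The Gaussian integral and its differential equation -/

/-- The integrand `s^(ν-1) e^(-xs-s²/2)` of the integral representation of `D_{-ν}(x)`. -/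
noncomputable def parabolicIntegrand (ν x : ℂ) (s : ℝ) : ℂ :=
  (s : ℂ) ^ (ν - 1) * Complex.exp (-x * s - (s : ℂ) ^ 2 / 2)

/-- The integral `∫₀^∞ s^(ν-1) e^(-xs-s²/2) ds`. -/
noncomputable def parabolicIntegral (ν x : ℂ) : ℂ :=
  ∫ s in Ioi (0 : ℝ), parabolicIntegrand ν x s

theorem integrableOn_rpow_mul_exp_linear_sub_sq {σ : ℝ} (hσ : 0 < σ) (A : ℝ) :
    IntegrableOn (fun s : ℝ => s ^ (σ - 1) * Real.exp (A * s - s ^ 2 / 2)) (Ioi 0) := by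
  -- Completing the square, `A s ≤ A² + s²/4`; half of the Gaussian remains for integrability.
  have h := (integrableOn_rpow_mul_exp_neg_mul_sq (b := 1 / 4) (by norm_num)
    (s := σ - 1) (by linarith)).const_mul (Real.exp (A ^ 2))
  refine Integrable.mono' h (Measurable.aestronglyMeasurable (by fun_prop)) ?_
  refine (ae_restrict_iff' measurableSet_Ioi).2 (Eventually.of_forall fun s hs => ?_)
  have hs' : 0 ≤ s ^ (σ - 1) := Real.rpow_nonneg (le_of_lt hs) _
  rw [Real.norm_of_nonneg (by positivity), mul_left_comm, ← Real.exp_add]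
  refine mul_le_mul_of_nonneg_left (Real.exp_le_exp.2 ?_) hs'
  nlinarith [sq_nonneg (A - s / 2)]

@[fun_prop]
theorem measurable_parabolicIntegrand (ν x : ℂ) : Measurable (parabolicIntegrand ν x) := by
  unfold parabolicIntegrand
  fun_prop

theorem norm_parabolicIntegrand (ν x : ℂ) {s : ℝ} (hs : 0 < s) :
    ‖parabolicIntegrand ν x s‖ = s ^ (ν.re - 1) * Real.exp (-x.re * s - s ^ 2 / 2) := by
  rw [parabolicIntegrand, norm_mul, Complex.norm_cpow_eq_rpow_re_of_pos hs, Complex.norm_exp]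
  congr 2
  have : -x * s - (s : ℂ) ^ 2 / 2 = -x * s - ((s ^ 2 / 2 : ℝ) : ℂ) := by push_cast; ring
  rw [this, Complex.sub_re, Complex.ofReal_re, Complex.re_mul_ofReal, Complex.neg_re]

theorem integrableOn_parabolicIntegrand {ν : ℂ} (hν : 0 < ν.re) (x : ℂ) :
    IntegrableOn (parabolicIntegrand ν x) (Ioi 0) := by
  refine Integrable.mono' (integrableOn_rpow_mul_exp_linear_sub_sq hν (-x.re))
    (measurable_parabolicIntegrand ν x).aestronglyMeasurable ?_
  exact (ae_restrict_iff' measurableSet_Ioi).2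
    (Eventually.of_forall fun s hs => (norm_parabolicIntegrand ν x hs).le)

theorem ofReal_mul_parabolicIntegrand (ν x : ℂ) {s : ℝ} (hs : 0 < s) :
    (s : ℂ) * parabolicIntegrand ν x s = parabolicIntegrand (ν + 1) x s := by
  have hs' : (s : ℂ) ≠ 0 := Complex.ofReal_ne_zero.2 hs.ne'
  rw [parabolicIntegrand, parabolicIntegrand, show ν + 1 - 1 = (ν - 1) + 1 by ring,
    Complex.cpow_add _ _ hs', Complex.cpow_one]
  ring

theorem hasDerivAt_parabolicIntegral {ν : ℂ} (hν : 0 < ν.re) (x : ℂ) :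
    HasDerivAt (parabolicIntegral ν) (-parabolicIntegral (ν + 1) x) x := by
  have hν' : 0 < (ν + 1).re := by simp; linarith
  have key := (hasDerivAt_integral_of_dominated_loc_of_deriv_le
    (μ := volume.restrict (Ioi (0 : ℝ))) (x₀ := x)
    (F := fun x s => parabolicIntegrand ν x s)
    (F' := fun x s => -parabolicIntegrand (ν + 1) x s)
    (bound := fun s => s ^ ((ν + 1).re - 1) * Real.exp ((-x.re + 1) * s - s ^ 2 / 2))
    (Metric.ball_mem_nhds x one_pos)
    (Eventually.of_forall fun z => (measurable_parabolicIntegrand ν z).aestronglyMeasurable)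
    (integrableOn_parabolicIntegrand hν x)
    (measurable_parabolicIntegrand _ x).neg.aestronglyMeasurable ?_
    (integrableOn_rpow_mul_exp_linear_sub_sq hν' _) ?_).2
  · rw [integral_neg] at key
    exact key
  · refine (ae_restrict_iff' measurableSet_Ioi).2 (Eventually.of_forall fun s hs z hz => ?_)
    have hs0 : 0 < s := hs
    rw [norm_neg, norm_parabolicIntegrand _ _ hs]
    have h1 : |(z - x).re| ≤ 1 := (Complex.abs_re_le_norm _).trans (mem_ball_iff_norm.1 hz).le
    rw [Complex.sub_re, abs_le] at h1
    gcongr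
    linarith
  · refine (ae_restrict_iff' measurableSet_Ioi).2 (Eventually.of_forall fun s hs z hz => ?_)
    rw [← ofReal_mul_parabolicIntegrand _ _ hs]
    have h1 : HasDerivAt (fun z : ℂ => -z * s - (s : ℂ) ^ 2 / 2) (-1 * (s : ℂ)) z :=
      ((hasDerivAt_id' z).fun_neg.mul_const (s : ℂ)).sub_const ((s : ℂ) ^ 2 / 2)
    refine (h1.cexp.const_mul ((s : ℂ) ^ (ν - 1))).congr_deriv ?_
    rw [parabolicIntegrand]
    ring

/-- Integrate the derivative of `s^ν e^(-xs-s²/2)` over the half-line; the boundary terms vanish, at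
`0` because `Re ν > 0`. As differentiation in `x` is `ν ↦ ν + 1` up to sign, this recurrence is the
equation `U'' = x U' + ν U`. -/
theorem parabolicIntegral_add_two {ν : ℂ} (hν : 0 < ν.re) (x : ℂ) :
    parabolicIntegral (ν + 2) x = ν * parabolicIntegral ν x - x * parabolicIntegral (ν + 1) x := by
  have hν1 : 0 < (ν + 1).re := by simp; linarith
  have hν2 : 0 < (ν + 2).re := by simp; linarith
  have hν0 : ν ≠ 0 := by rintro rfl; simp at hν
  have i0 := (integrableOn_parabolicIntegrand hν x).const_mul ν
  have i1 := (integrableOn_parabolicIntegrand hν1 x).const_mul x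
  have i2 := integrableOn_parabolicIntegrand hν2 x
  have hd : ∀ s ∈ Ioi (0 : ℝ), HasDerivAt (parabolicIntegrand (ν + 1) x)
      (ν * parabolicIntegrand ν x s - x * parabolicIntegrand (ν + 1) x s
        - parabolicIntegrand (ν + 2) x s) s := by
    intro s hs
    have h1 : HasDerivAt (fun s : ℝ => (s : ℂ) ^ (ν + 1 - 1)) (ν * (s : ℂ) ^ (ν - 1)) s := by
      simpa only [add_sub_cancel_right] using hasDerivAt_ofReal_cpow_const (ne_of_gt hs) hν0
    have h2 : HasDerivAt (fun s : ℝ => -x * s - (s : ℂ) ^ 2 / 2) (-x - s) s := by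
      have h3 := (hasDerivAt_id' s).ofReal_comp
      refine ((h3.const_mul (-x)).sub ((h3.pow 2).div_const 2)).congr_deriv ?_
      simp
    refine (h1.mul h2.cexp).congr_deriv ?_
    rw [show ν + 2 = ν + 1 + 1 by ring, ← ofReal_mul_parabolicIntegrand (ν + 1) x hs,
      ← ofReal_mul_parabolicIntegrand ν x hs, parabolicIntegrand, add_sub_cancel_right,
      show ν = (ν - 1) + 1 by ring, Complex.cpow_add _ _ (Complex.ofReal_ne_zero.2 (ne_of_gt hs)),
      Complex.cpow_one, add_sub_cancel_right]
    ring
  have i01 : IntegrableOn (fun s => ν * parabolicIntegrand ν x s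
    - x * parabolicIntegrand (ν + 1) x s) (Ioi 0) := i0.sub i1
  have hint := i01.sub i2
  have key := integral_Ioi_of_hasDerivAt_of_tendsto (f := parabolicIntegrand (ν + 1) x)
    (ContinuousAt.continuousWithinAt (ContinuousAt.mul
      (Complex.continuousAt_ofReal_cpow_const _ _ (Or.inl (by simpa using hν))) (by fun_prop)))
    hd hint (tendsto_zero_of_hasDerivAt_of_integrableOn_Ioi hd hint
      (integrableOn_parabolicIntegrand hν1 x))
  have h0 : parabolicIntegrand (ν + 1) x 0 = 0 := by
    simp [parabolicIntegrand, Complex.zero_cpow hν0]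
  rw [h0, sub_zero, integral_sub i01 i2, integral_sub i0 i1, integral_const_mul,
    integral_const_mul] at key
  simp only [parabolicIntegral]
  linear_combination -key

theorem norm_parabolicIntegral_add_le {ν : ℂ} (hν : 0 < ν.re) (x : ℂ) :
    ∃ C : ℝ, ∀ τ : ℝ, 0 ≤ τ → ‖parabolicIntegral ν (x + τ)‖ ≤ C := by
  refine ⟨∫ s in Ioi (0 : ℝ), s ^ (ν.re - 1) * Real.exp (-x.re * s - s ^ 2 / 2), fun τ hτ => ?_⟩
  refine norm_integral_le_of_norm_le (integrableOn_rpow_mul_exp_linear_sub_sq hν (-x.re)) ?_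
  refine (ae_restrict_iff' measurableSet_Ioi).2 (Eventually.of_forall fun s hs => ?_)
  have hs0 : 0 < s := hs
  rw [norm_parabolicIntegrand _ _ hs, Complex.add_re, Complex.ofReal_re]
  gcongr
  linarith

/-! ### Asymptotics of the Gaussian integral along horizontal rays -/

theorem cpow_mul_parabolicIntegral (ν x : ℂ) {τ : ℝ} (hτ : 0 < τ) :
    (τ : ℂ) ^ ν * parabolicIntegral ν x = ∫ v in Ioi (0 : ℝ),
      (v : ℂ) ^ (ν - 1) * Complex.exp (-x * (v / τ) - ((v : ℂ) / τ) ^ 2 / 2) := by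
  have h := integral_comp_mul_left_Ioi (parabolicIntegrand ν x) 0 (inv_pos.2 hτ)
  rw [mul_zero, inv_inv] at h
  have hτ0 : (τ : ℂ) ≠ 0 := Complex.ofReal_ne_zero.2 hτ.ne'
  have : (τ : ℂ) ^ ν * parabolicIntegral ν x = (τ : ℂ) ^ (ν - 1) *
      ∫ v in Ioi (0 : ℝ), parabolicIntegrand ν x (τ⁻¹ * v) := by
    rw [h, Complex.real_smul, ← mul_assoc, Complex.cpow_sub _ _ hτ0, Complex.cpow_one,
      div_mul_cancel₀ _ hτ0]
    rfl
  rw [this, ← integral_const_mul]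
  refine setIntegral_congr_fun measurableSet_Ioi fun v hv => ?_
  have hv0 : 0 < v := hv
  have h2 : (τ : ℂ) ^ (ν - 1) * ((τ⁻¹ * v : ℝ) : ℂ) ^ (ν - 1) = (v : ℂ) ^ (ν - 1) := by
    rw [← Complex.mul_cpow_ofReal_nonneg hτ.le (by positivity), ← Complex.ofReal_mul,
      mul_inv_cancel_left₀ hτ.ne']
  simp only [parabolicIntegrand]
  rw [← mul_assoc, h2]
  push_cast
  congr 3 <;> ring

/-- After the substitution `s = v/τ` the exponent tends to `-v`, leaving Euler's integral. -/
theorem tendsto_cpow_mul_parabolicIntegral {ν : ℂ} (hν : 0 < ν.re) (x : ℂ) :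
    Tendsto (fun τ : ℝ => (τ : ℂ) ^ ν * parabolicIntegral ν (x + τ)) atTop
      (𝓝 (Complex.Gamma ν)) := by
  have hlim : Complex.Gamma ν =
      ∫ v in Ioi (0 : ℝ), (v : ℂ) ^ (ν - 1) * Complex.exp (-v) := by
    have := Complex.integral_cpow_mul_exp_neg_mul_Ioi hν one_pos
    simpa using this.symm
  rw [hlim]
  have hb : IntegrableOn (fun v : ℝ => v ^ (ν.re - 1) * Real.exp (-(1 / 2) * v)) (Ioi 0) := by
    have := integrableOn_rpow_mul_exp_neg_mul_rpow (p := 1) (s := ν.re - 1) (b := 1 / 2)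
      (by linarith) one_pos (by norm_num)
    simpa only [Real.rpow_one] using this
  refine Tendsto.congr' (f₁ := fun τ : ℝ => ∫ v in Ioi (0 : ℝ),
      (v : ℂ) ^ (ν - 1) * Complex.exp (-(x + τ) * (v / τ) - ((v : ℂ) / τ) ^ 2 / 2)) ?_
    (tendsto_integral_filter_of_dominated_convergence _ ?_ ?_ hb ?_)
  · filter_upwards [eventually_gt_atTop 0] with τ hτ
    exact (cpow_mul_parabolicIntegral ν _ hτ).symm
  · exact Eventually.of_forall fun τ => Measurable.aestronglyMeasurable (by fun_prop)
  -- Once `τ ≥ 2‖x‖`, `Re (x + τ) ≥ τ/2`, so the rescaled exponential is at most `e^(-v/2)`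
  -- uniformly in `τ`.
  · filter_upwards [eventually_gt_atTop 0, eventually_ge_atTop (2 * ‖x‖)] with τ hτ hτx
    refine (ae_restrict_iff' measurableSet_Ioi).2 (Eventually.of_forall fun v hv => ?_)
    have hv0 : 0 < v := hv
    have h1 : -(x + τ) * (v / τ) - ((v : ℂ) / τ) ^ 2 / 2
        = (-(x + τ)) * ((v / τ : ℝ) : ℂ) - (((v / τ) ^ 2 / 2 : ℝ) : ℂ) := by push_cast; ring
    rw [norm_mul, Complex.norm_cpow_eq_rpow_re_of_pos hv0, Complex.norm_exp, h1,
      Complex.sub_re (-(x + τ) * _), Complex.ofReal_re, Complex.re_mul_ofReal, Complex.neg_re,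
      Complex.add_re, Complex.ofReal_re, Complex.sub_re, Complex.one_re]
    have h2 : -‖x‖ ≤ x.re := (abs_le.1 (Complex.abs_re_le_norm x)).1
    have h3 : (τ / 2) * (v / τ) = 1 / 2 * v := by field_simp
    have h4 : 0 ≤ v / τ := by positivity
    gcongr
    nlinarith [sq_nonneg (v / τ)]
  · refine (ae_restrict_iff' measurableSet_Ioi).2 (Eventually.of_forall fun v hv => ?_)
    have hinv : Tendsto (fun τ : ℝ => (v : ℂ) / τ) atTop (𝓝 0) := by
      have := ((tendsto_inv_atTop_zero (𝕜 := ℝ)).const_mul v).ofReal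
      simpa [div_eq_mul_inv] using this
    have h1 : Tendsto (fun τ : ℝ => -x * (v / τ) - v - ((v : ℂ) / τ) ^ 2 / 2) atTop
        (𝓝 (-x * 0 - v - 0 ^ 2 / 2)) :=
      ((hinv.const_mul (-x)).sub_const _).sub ((hinv.pow 2).div_const 2)
    have h2 : -x * 0 - (v : ℂ) - 0 ^ 2 / 2 = -v := by ring
    rw [h2] at h1
    refine Tendsto.const_mul _ ((Complex.continuous_exp.tendsto _).comp (h1.congr' ?_))
    filter_upwards [eventually_gt_atTop 0] with τ hτ
    have hτ0 : (τ : ℂ) ≠ 0 := Complex.ofReal_ne_zero.2 hτ.ne'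
    field_simp
    ring

/-! ### Identification with the parabolic cylinder function -/

theorem hasSum_kummerM (α : ℂ) {γ : ℂ} (z : ℂ) :
    HasSum (fun n : ℕ => Complex.Gamma γ * ((ascPochhammer ℂ n).eval α /
      (n.factorial * Complex.Gamma (γ + n)) * z ^ n)) (kummerM α γ z) := by
  refine HasSum.mul_left _ ?_
  have h := (Complex.regularizedHGFunSeries {α} {γ}).hasSum (x := z) (by
    rw [Complex.radius_regularizedHGFunSeries_eq_top (by simp)]
    simp)
  refine h.congr_fun fun n => ?_
  simp [Complex.regularizedHGFunSeries, Complex.regularizedHGFunCoeff, mul_comm]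

theorem parabolicIntegral_zero {ν : ℂ} (hν : 0 < ν.re) :
    parabolicIntegral ν 0 = 2 ^ (ν / 2 - 1) * Complex.Gamma (ν / 2) := by
  have hν2 : 0 < (ν / 2).re := by
    rw [Complex.div_ofNat_re]; positivity
  have h := Complex.integral_cpow_mul_exp_neg_mul_Ioi hν2 (r := 1 / 2) (by norm_num)
  rw [← integral_comp_rpow_Ioi_of_pos two_pos] at h
  have h2 : ∫ s in Ioi (0 : ℝ), 2 * parabolicIntegrand ν 0 s
      = (1 / ((1 / 2 : ℝ) : ℂ)) ^ (ν / 2) * Complex.Gamma (ν / 2) := by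
    rw [← h]
    refine setIntegral_congr_fun measurableSet_Ioi fun s hs => ?_
    have hs0 : 0 < s := hs
    have hsc : (s : ℂ) ≠ 0 := Complex.ofReal_ne_zero.2 hs0.ne'
    have h3 : ((s ^ (2 : ℝ) : ℝ) : ℂ) ^ (ν / 2 - 1) = (s : ℂ) ^ (ν - 1 - 1) := by
      rw [Real.rpow_two, sq, Complex.ofReal_mul, Complex.mul_cpow_ofReal_nonneg hs0.le hs0.le,
        ← Complex.cpow_add _ _ hsc]
      congr 1
      ring
    simp only [parabolicIntegrand]
    rw [h3, Complex.cpow_sub (ν - 1) _ hsc, Complex.cpow_one, Complex.real_smul,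
      show (2 : ℝ) - 1 = 1 by norm_num, Real.rpow_one, Real.rpow_two,
      show -0 * (s : ℂ) - (s : ℂ) ^ 2 / 2 = -(((1 / 2 : ℝ) : ℂ) * (s ^ 2 : ℝ)) by push_cast; ring]
    generalize (s : ℂ) ^ (ν - 1) = p
    push_cast
    field_simp
  rw [integral_const_mul] at h2
  rw [Complex.cpow_sub _ _ two_ne_zero, Complex.cpow_one, parabolicIntegral]
  have h4 : (1 / ((1 / 2 : ℝ) : ℂ)) = 2 := by push_cast; norm_num
  rw [h4] at h2
  linear_combination h2 / 2

theorem parabolicIntegrand_add_natCast (ν x : ℂ) (n : ℕ) {s : ℝ} (hs : 0 < s) :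
    parabolicIntegrand (ν + n) x s = (s : ℂ) ^ n * parabolicIntegrand ν x s := by
  induction n with
  | zero => simp
  | succ k ih =>
    rw [Nat.cast_succ, ← add_assoc, ← ofReal_mul_parabolicIntegrand _ _ hs, ih]
    ring

/-- Expand `e^(-xs)` and integrate termwise; the absolute values sum to the integrand with `-x`
replaced by `‖x‖`, which is integrable. -/
theorem hasSum_parabolicIntegral {ν : ℂ} (hν : 0 < ν.re) (x : ℂ) :
    HasSum (fun n : ℕ => (-x) ^ n / n.factorial * parabolicIntegral (ν + n) 0)
      (parabolicIntegral ν x) := by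
  have hexp : ∀ s : ℝ, HasSum (fun n : ℕ => (‖x‖ * s) ^ n / n.factorial)
      (Real.exp (‖x‖ * s)) := fun s => by
    rw [Real.exp_eq_exp_ℝ]
    exact NormedSpace.expSeries_div_hasSum_exp (‖x‖ * s)
  have hsum : ∀ s : ℝ, ∑' n : ℕ, s ^ (ν.re - 1) * Real.exp (-s ^ 2 / 2) *
      ((‖x‖ * s) ^ n / n.factorial) = s ^ (ν.re - 1) * Real.exp (‖x‖ * s - s ^ 2 / 2) := by
    intro s
    rw [((hexp s).mul_left _).tsum_eq, mul_assoc, ← Real.exp_add]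
    ring_nf
  have key := hasSum_integral_of_dominated_convergence (μ := volume.restrict (Ioi (0 : ℝ)))
    (F := fun (n : ℕ) s => (-x) ^ n / n.factorial * parabolicIntegrand (ν + n) 0 s)
    (f := parabolicIntegrand ν x)
    (fun (n : ℕ) s => s ^ (ν.re - 1) * Real.exp (-s ^ 2 / 2) * ((‖x‖ * s) ^ n / n.factorial))
    (fun n => Measurable.aestronglyMeasurable (by fun_prop)) ?_ ?_ ?_ ?_
  · simp only [integral_const_mul] at key
    exact key
  · refine fun n => (ae_restrict_iff' measurableSet_Ioi).2 (Eventually.of_forall fun s hs => ?_)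
    have hs0 : 0 < s := hs
    rw [parabolicIntegrand_add_natCast _ _ _ hs0, norm_mul, norm_mul,
      norm_parabolicIntegrand _ _ hs0]
    simp only [norm_div, norm_pow, norm_neg, Complex.norm_natCast, Complex.norm_real,
      Real.norm_of_nonneg hs0.le, Complex.zero_re, neg_zero, zero_mul, zero_sub]
    rw [neg_div]
    apply le_of_eq
    ring
  · exact Eventually.of_forall fun s => (hexp s).summable.mul_left _
  · simp_rw [hsum]
    exact integrableOn_rpow_mul_exp_linear_sub_sq hν _
  · refine (ae_restrict_iff' measurableSet_Ioi).2 (Eventually.of_forall fun s hs => ?_)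
    have h1 : HasSum (fun n : ℕ => (-x * s) ^ n / n.factorial) (Complex.exp (-x * s)) := by
      rw [Complex.exp_eq_exp_ℂ]
      exact NormedSpace.expSeries_div_hasSum_exp (-x * (s : ℂ))
    have h2 := h1.mul_left (parabolicIntegrand ν 0 s)
    have h3 : parabolicIntegrand ν 0 s * Complex.exp (-x * s) = parabolicIntegrand ν x s := by
      simp only [parabolicIntegrand]
      rw [mul_assoc, ← Complex.exp_add]
      ring_nf
    rw [h3] at h2
    refine h2.congr_fun fun n => ?_
    rw [parabolicIntegrand_add_natCast _ _ _ hs]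
    ring

/-- The even and odd terms of the power series in `x` are the two Kummer series. Moments at `0` are
Gamma values, and raising `ν` by `2k` produces the Pochhammer symbol in the numerator. -/
theorem parabolicIntegral_eq_kummerM {ν : ℂ} (hν : 0 < ν.re) (x : ℂ) :
    parabolicIntegral ν x =
      2 ^ (ν / 2 - 1) * Complex.Gamma (ν / 2) * kummerM (ν / 2) (1 / 2) (x ^ 2 / 2)
      - x * (2 ^ ((ν + 1) / 2 - 1) * Complex.Gamma ((ν + 1) / 2) *
        kummerM ((ν + 1) / 2) (3 / 2) (x ^ 2 / 2)) := by
  have hpoch : ∀ {α : ℂ}, 0 < α.re → ∀ k : ℕ,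
      (ascPochhammer ℂ k).eval α * Complex.Gamma α = Complex.Gamma (α + k) := by
    intro α hα k
    rw [← Complex.Gamma_add_nat_div_Gamma_eq, div_mul_cancel₀]
    · exact Complex.Gamma_ne_zero_of_re_pos hα
    · rintro m rfl
      simp at hα
      linarith [(Nat.cast_nonneg m : (0 : ℝ) ≤ m)]
  have h2 : ∀ (α : ℂ) (k : ℕ), (2 : ℂ) ^ (α + k) = 2 ^ α * 2 ^ k := fun α k => by
    rw [Complex.cpow_add _ _ two_ne_zero, Complex.cpow_natCast]
  have hhalf : Complex.Gamma (1 / 2) = (Real.sqrt Real.pi : ℂ) := by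
    rw [Complex.Gamma_one_half_eq, Real.sqrt_eq_rpow, Complex.ofReal_cpow Real.pi_pos.le]
    simp
  have hthree : Complex.Gamma (3 / 2) = (Real.sqrt Real.pi : ℂ) / 2 := by
    rw [show (3 / 2 : ℂ) = 1 / 2 + 1 by norm_num, Complex.Gamma_add_one _ (by norm_num), hhalf]
    ring
  -- Legendre duplication at `1/2 + k` splits `(2k)!` into `k!` and the denominator symbol of
  -- parameter `1/2`; at `k + 1` it does the same for `(2k+1)!` and `3/2`.
  have heven : ∀ k : ℕ, (k.factorial : ℂ) * Complex.Gamma (1 / 2 + k) * 2 ^ k * 2 ^ k =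
      Real.sqrt Real.pi * (2 * k).factorial := by
    intro k
    have h := Complex.Gamma_mul_Gamma_add_half (1 / 2 + (k : ℂ))
    rw [show (1 / 2 + (k : ℂ)) + 1 / 2 = k + 1 by ring, Complex.Gamma_nat_eq_factorial,
      show 2 * (1 / 2 + (k : ℂ)) = (2 * k : ℕ) + 1 by push_cast; ring,
      Complex.Gamma_nat_eq_factorial, show (1 : ℂ) - ((2 * k : ℕ) + 1) = -((2 * k : ℕ) : ℂ) by ring,
      Complex.cpow_neg, Complex.cpow_natCast, two_mul, pow_add] at h
    rw [two_mul]
    generalize Complex.Gamma (1 / 2 + k) = g at h ⊢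
    field_simp at h
    linear_combination h
  have hodd : ∀ k : ℕ, (k.factorial : ℂ) * Complex.Gamma (3 / 2 + k) * 2 ^ k * 2 ^ k * 2 =
      Real.sqrt Real.pi * (2 * k + 1).factorial := by
    intro k
    have h := Complex.Gamma_mul_Gamma_add_half ((k : ℂ) + 1)
    rw [show (k : ℂ) + 1 + 1 / 2 = 3 / 2 + k by ring, Complex.Gamma_nat_eq_factorial,
      show 2 * ((k : ℂ) + 1) = (2 * k + 1 : ℕ) + 1 by push_cast; ring,
      Complex.Gamma_nat_eq_factorial,
      show (1 : ℂ) - ((2 * k + 1 : ℕ) + 1) = -((2 * k + 1 : ℕ) : ℂ) by ring,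
      Complex.cpow_neg, Complex.cpow_natCast, two_mul, pow_succ, pow_add] at h
    rw [two_mul]
    generalize Complex.Gamma (3 / 2 + k) = g at h ⊢
    field_simp at h
    linear_combination h
  have hGhalf : ∀ k : ℕ, Complex.Gamma (1 / 2 + k) ≠ 0 := fun k =>
    Complex.Gamma_ne_zero_of_re_pos (by
      rw [Complex.add_re, Complex.natCast_re]; norm_num; positivity)
  have hGthree : ∀ k : ℕ, Complex.Gamma (3 / 2 + k) ≠ 0 := fun k =>
    Complex.Gamma_ne_zero_of_re_pos (by
      rw [Complex.add_re, Complex.natCast_re]; norm_num; positivity)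
  have hfac : ∀ k : ℕ, (k.factorial : ℂ) ≠ 0 := fun k => Nat.cast_ne_zero.2 k.factorial_ne_zero
  have hre : 0 < (ν / 2).re := by rw [Complex.div_ofNat_re]; positivity
  have hre1 : 0 < ((ν + 1) / 2).re := by
    rw [Complex.div_ofNat_re, Complex.add_re, Complex.one_re]; positivity
  have hpos : ∀ n : ℕ, 0 < (ν + n).re := fun n => by
    rw [Complex.add_re, Complex.natCast_re]; positivity
  refine (hasSum_parabolicIntegral hν x).unique ?_
  rw [sub_eq_add_neg]
  refine HasSum.even_add_odd ?_ ?_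
  · refine ((hasSum_kummerM (ν / 2) (γ := 1 / 2) (x ^ 2 / 2)).mul_left
      (2 ^ (ν / 2 - 1) * Complex.Gamma (ν / 2))).congr_fun fun k => ?_
    rw [parabolicIntegral_zero (hpos _), hhalf,
      show (ν + (2 * k : ℕ)) / 2 = ν / 2 + k by push_cast; ring,
      show ν / 2 + k - 1 = ν / 2 - 1 + (k : ℂ) by ring, h2, ← hpoch hre, pow_mul, div_pow, neg_sq]
    have h0 := hGhalf k
    have h1 := heven k
    have := hfac k
    have := hfac (2 * k)
    generalize Complex.Gamma (1 / 2 + k) = g at h0 h1 ⊢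
    field_simp
    linear_combination (x ^ (k * 2) * Polynomial.eval (ν / 2) (ascPochhammer ℂ k) *
      Complex.Gamma (ν / 2)) * h1
  · refine (((hasSum_kummerM ((ν + 1) / 2) (γ := 3 / 2) (x ^ 2 / 2)).mul_left
      (2 ^ ((ν + 1) / 2 - 1) * Complex.Gamma ((ν + 1) / 2))).mul_left x).neg.congr_fun fun k => ?_
    rw [parabolicIntegral_zero (hpos _), hthree,
      show (ν + (2 * k + 1 : ℕ)) / 2 = (ν + 1) / 2 + k by push_cast; ring,
      show (ν + 1) / 2 + k - 1 = (ν + 1) / 2 - 1 + (k : ℂ) by ring, h2, ← hpoch hre1, pow_succ,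
      pow_mul, div_pow, neg_sq]
    have h0 := hGthree k
    have h1 := hodd k
    have := hfac k
    have := hfac (2 * k + 1)
    generalize Complex.Gamma (3 / 2 + k) = g at h0 h1 ⊢
    field_simp
    linear_combination (-x * x ^ (k * 2) * Polynomial.eval ((ν + 1) / 2) (ascPochhammer ℂ k) *
      Complex.Gamma ((ν + 1) / 2)) * h1

/-- Duplication for `Γ(ν/2) Γ((ν+1)/2)` matches the coefficients of both Kummer functions. -/
theorem Gamma_mul_parabolicCylinderD_neg {ν : ℂ} (hν : 0 < ν.re) (x : ℂ) :
    Complex.Gamma ν * parabolicCylinderD (-ν) x =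
      Complex.exp (-x ^ 2 / 4) * parabolicIntegral ν x := by
  have hre : 0 < (ν / 2).re := by rw [Complex.div_ofNat_re]; positivity
  have hre1 : 0 < ((ν + 1) / 2).re := by
    rw [Complex.div_ofNat_re, Complex.add_re, Complex.one_re]; positivity
  have hG := Complex.Gamma_ne_zero_of_re_pos hre
  have hG1 := Complex.Gamma_ne_zero_of_re_pos hre1
  have hdup := Complex.Gamma_mul_Gamma_add_half (ν / 2)
  have hp : (2 : ℂ) ^ (ν / 2) ≠ 0 := by simp [Complex.cpow_eq_zero_iff]
  have hr : (Real.sqrt 2 : ℂ) ≠ 0 := Complex.ofReal_ne_zero.2 (by positivity)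
  have hrc : (2 : ℂ) ^ (1 / 2 : ℂ) = (Real.sqrt 2 : ℂ) := by
    rw [Real.sqrt_eq_rpow, Complex.ofReal_cpow zero_le_two]; simp
  rw [show ν / 2 + 1 / 2 = (ν + 1) / 2 by ring, show 2 * (ν / 2) = ν by ring,
    show 1 - ν = 1 - (ν / 2 + ν / 2) by ring, Complex.cpow_sub _ _ two_ne_zero, Complex.cpow_one,
    Complex.cpow_add _ _ two_ne_zero] at hdup
  rw [parabolicIntegral_eq_kummerM hν, parabolicCylinderD, neg_neg, show 1 - -ν = ν + 1 by ring,
    show -ν / 2 = -(ν / 2) by ring, Complex.cpow_neg, Complex.cpow_sub _ _ two_ne_zero,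
    Complex.cpow_one, show (ν + 1) / 2 - 1 = ν / 2 + 1 / 2 - 1 by ring,
    Complex.cpow_sub _ _ two_ne_zero,
    Complex.cpow_add _ _ two_ne_zero, Complex.cpow_one, hrc, Real.sqrt_mul zero_le_two,
    Complex.ofReal_mul]
  generalize kummerM _ _ _ = K1
  generalize kummerM _ _ _ = K2
  field_simp at hdup ⊢
  rw [← hdup]

/-! ### Laplace integrals of tempered weights -/

/-- A measurable function `g` on `(0, ∞)` such that `g(t) e^(-δt)` is integrable for all `δ > 0`. -/
structure IsTemperedWeight (g : ℝ → ℂ) : Prop where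
  measurable : Measurable g
  integrableOn : ∀ δ : ℝ, 0 < δ → IntegrableOn (fun t => ‖g t‖ * Real.exp (-δ * t)) (Ioi 0)

theorem sqrt_mul_add_one_le {t : ℝ} (ht : 0 ≤ t) : Real.sqrt (t * (t + 1)) ≤ t + 1 / 2 :=
  Real.sqrt_le_iff.2 ⟨by positivity, by nlinarith⟩

theorem le_sqrt_mul_add_one {t : ℝ} (ht : 0 ≤ t) : t ≤ Real.sqrt (t * (t + 1)) :=
  Real.le_sqrt_of_sq_le (by nlinarith)

theorem sqrt_mul_add_one_le_add_sqrt {t : ℝ} (ht : 0 ≤ t) :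
    Real.sqrt (t * (t + 1)) ≤ t + Real.sqrt t := by
  have h := Real.sqrt_nonneg t
  have h2 := Real.sq_sqrt ht
  exact Real.sqrt_le_iff.2 ⟨by positivity, by nlinarith [mul_nonneg ht h]⟩

/-- A linear factor is absorbed by half of the exponential decay. Differentiating the kernel in `x`
brings down `t` and `√(t(t+1))`, so the class of weights has to be stable under both. -/
theorem IsTemperedWeight.of_norm_le {g h : ℝ → ℂ} (hg : IsTemperedWeight g) (hh : Measurable h)
    (hle : ∀ t : ℝ, 0 < t → ‖h t‖ ≤ (t + 1) * ‖g t‖) : IsTemperedWeight h := by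
  refine ⟨hh, fun δ hδ => ?_⟩
  refine Integrable.mono' ((hg.integrableOn (δ / 2) (by positivity)).const_mul (2 / δ + 1))
    (Measurable.aestronglyMeasurable (by fun_prop)) ?_
  refine (ae_restrict_iff' measurableSet_Ioi).2 (Eventually.of_forall fun t ht => ?_)
  have ht0 : 0 < t := ht
  rw [Real.norm_of_nonneg (by positivity)]
  have h1 : δ / 2 * t + 1 ≤ Real.exp (δ / 2 * t) := Real.add_one_le_exp _
  have h2 : Real.exp (-δ * t) * Real.exp (δ / 2 * t) = Real.exp (-(δ / 2) * t) := by
    rw [← Real.exp_add]; ring_nf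
  have h3 : t + 1 ≤ (2 / δ + 1) * Real.exp (δ / 2 * t) := by
    have : t + 1 ≤ (2 / δ + 1) * (δ / 2 * t + 1) := by
      have h5 : (2 / δ + 1) * (δ / 2 * t + 1) = t + 1 + 2 / δ + δ / 2 * t := by
        field_simp
        ring
      rw [h5]
      have : 0 ≤ 2 / δ + δ / 2 * t := by positivity
      linarith
    exact this.trans (mul_le_mul_of_nonneg_left h1 (by positivity))
  calc ‖h t‖ * Real.exp (-δ * t)
      ≤ ((2 / δ + 1) * Real.exp (δ / 2 * t) * ‖g t‖) * Real.exp (-δ * t) := by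
        refine mul_le_mul_of_nonneg_right ((hle t ht0).trans ?_) (Real.exp_pos _).le
        exact mul_le_mul_of_nonneg_right h3 (norm_nonneg _)
    _ = (2 / δ + 1) * (‖g t‖ * Real.exp (-(δ / 2) * t)) := by
        rw [← h2]; ring

theorem IsTemperedWeight.ofReal_mul {g : ℝ → ℂ} (hg : IsTemperedWeight g) :
    IsTemperedWeight fun t => (t : ℂ) * g t := by
  have := hg.measurable
  refine hg.of_norm_le (by fun_prop) fun t ht => ?_
  rw [norm_mul, Complex.norm_real, Real.norm_of_nonneg ht.le]
  gcongr
  linarith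

theorem IsTemperedWeight.sqrt_mul {g : ℝ → ℂ} (hg : IsTemperedWeight g) :
    IsTemperedWeight fun t => (Real.sqrt (t * (t + 1)) : ℂ) * g t := by
  have := hg.measurable
  refine hg.of_norm_le (by fun_prop) fun t ht => ?_
  rw [norm_mul, Complex.norm_real, Real.norm_of_nonneg (Real.sqrt_nonneg _)]
  have := sqrt_mul_add_one_le ht.le
  gcongr
  linarith

/-- The exponential `e^(-(x²+y²)t/2 - xy√(t(t+1)))`. -/
noncomputable def laplaceKernel (x y : ℂ) (t : ℝ) : ℂ :=
  Complex.exp (-((x ^ 2 + y ^ 2) / 2) * t - x * y * (Real.sqrt (t * (t + 1)) : ℂ))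

@[fun_prop]
theorem measurable_laplaceKernel (x y : ℂ) : Measurable (laplaceKernel x y) := by
  unfold laplaceKernel
  fun_prop

/-- The decay in `t` is governed by `(x+y)²`: replacing `√(t(t+1))` by `t` completes the square, and
the remaining difference is nonnegative. That difference is kept here because the limit `x → ∞`
needs it bounded by `√t`; the cruder constant bound below suffices for fixed `x`. -/
theorem norm_laplaceKernel_le (x y : ℂ) {t : ℝ} (ht : 0 ≤ t) :
    ‖laplaceKernel x y t‖ ≤ Real.exp (-(((x + y) ^ 2).re / 2) * t +
      ‖x‖ * ‖y‖ * (Real.sqrt (t * (t + 1)) - t)) := by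
  have h1 : -((x ^ 2 + y ^ 2) / 2) * t - x * y * (Real.sqrt (t * (t + 1)) : ℂ) =
      -((x + y) ^ 2 / 2) * t + -(x * y) * ((Real.sqrt (t * (t + 1)) - t : ℝ) : ℂ) := by
    push_cast; ring
  rw [laplaceKernel, Complex.norm_exp, h1, Complex.add_re, Complex.re_mul_ofReal,
    Complex.re_mul_ofReal, Complex.neg_re, Complex.div_ofNat_re]
  refine Real.exp_le_exp.2 (add_le_add le_rfl (mul_le_mul_of_nonneg_right ?_
    (sub_nonneg.2 (le_sqrt_mul_add_one ht))))
  rw [← norm_mul, ← norm_neg]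
  exact Complex.re_le_norm _

theorem norm_laplaceKernel_le' (x y : ℂ) {t : ℝ} (ht : 0 ≤ t) :
    ‖laplaceKernel x y t‖ ≤ Real.exp (‖x‖ * ‖y‖) * Real.exp (-(((x + y) ^ 2).re / 2) * t) := by
  refine (norm_laplaceKernel_le x y ht).trans ?_
  rw [← Real.exp_add, add_comm]
  have h1 := sqrt_mul_add_one_le ht
  have h2 : ‖x‖ * ‖y‖ * (Real.sqrt (t * (t + 1)) - t) ≤ ‖x‖ * ‖y‖ * 1 :=
    mul_le_mul_of_nonneg_left (by linarith) (by positivity)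
  refine Real.exp_le_exp.2 ?_
  linarith

/-- The integral of a weight against `laplaceKernel`. -/
noncomputable def weightedLaplace (g : ℝ → ℂ) (x y : ℂ) : ℂ :=
  ∫ t in Ioi (0 : ℝ), g t * laplaceKernel x y t

theorem IsTemperedWeight.integrableOn_mul_laplaceKernel {g : ℝ → ℂ} (hg : IsTemperedWeight g)
    {x y : ℂ} (hxy : 0 < ((x + y) ^ 2).re) :
    IntegrableOn (fun t => g t * laplaceKernel x y t) (Ioi 0) := by
  have := hg.measurable
  refine Integrable.mono' ((hg.integrableOn (((x + y) ^ 2).re / 2) (by positivity)).const_mul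
    (Real.exp (‖x‖ * ‖y‖))) (Measurable.aestronglyMeasurable (by fun_prop)) ?_
  refine (ae_restrict_iff' measurableSet_Ioi).2 (Eventually.of_forall fun t ht => ?_)
  rw [norm_mul, mul_left_comm]
  exact mul_le_mul_of_nonneg_left (norm_laplaceKernel_le' x y (le_of_lt ht)) (norm_nonneg _)

theorem IsTemperedWeight.norm_weightedLaplace_le {g : ℝ → ℂ} (hg : IsTemperedWeight g)
    {δ : ℝ} (hδ : 0 < δ) (y : ℂ) :
    ∃ C : ℝ, ∀ x : ℂ, δ ≤ ((x + y) ^ 2).re →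
      ‖weightedLaplace g x y‖ ≤ C * Real.exp (‖x‖ * ‖y‖) := by
  refine ⟨∫ t in Ioi (0 : ℝ), ‖g t‖ * Real.exp (-(δ / 2) * t), fun x hx => ?_⟩
  rw [mul_comm, ← integral_const_mul]
  refine norm_integral_le_of_norm_le ((hg.integrableOn _ (by positivity)).const_mul _) ?_
  refine (ae_restrict_iff' measurableSet_Ioi).2 (Eventually.of_forall fun t ht => ?_)
  have ht0 : 0 < t := ht
  rw [norm_mul, mul_left_comm]
  refine mul_le_mul_of_nonneg_left ((norm_laplaceKernel_le' x y ht0.le).trans ?_) (norm_nonneg _)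
  gcongr

theorem hasDerivAt_laplaceKernel_left (x y : ℂ) (t : ℝ) :
    HasDerivAt (fun x => laplaceKernel x y t)
      ((-x * t - y * (Real.sqrt (t * (t + 1)) : ℂ)) * laplaceKernel x y t) x := by
  unfold laplaceKernel
  generalize (Real.sqrt (t * (t + 1)) : ℂ) = r
  have h1 : HasDerivAt (fun x : ℂ => -((x ^ 2 + y ^ 2) / 2) * (t : ℂ) - x * y * r)
      (-x * t - y * r) x := by
    have h2 := ((((hasDerivAt_pow 2 x).add_const (y ^ 2)).div_const 2).fun_neg.mul_const
      (t : ℂ)).sub (((hasDerivAt_id' x).mul_const y).mul_const r)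
    refine h2.congr_deriv ?_
    push_cast
    ring
  refine h1.cexp.congr_deriv (mul_comm _ _)

theorem IsTemperedWeight.hasDerivAt_weightedLaplace {g : ℝ → ℂ} (hg : IsTemperedWeight g)
    {x y : ℂ} (hxy : 0 < ((x + y) ^ 2).re) :
    HasDerivAt (fun x => weightedLaplace g x y)
      (-x * weightedLaplace (fun t => (t : ℂ) * g t) x y
        - y * weightedLaplace (fun t => (Real.sqrt (t * (t + 1)) : ℂ) * g t) x y) x := by
  have hm := hg.measurable
  -- Half of the available margin: near `x` the real part of `(z+y)²` stays above `δ`, giving a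
  -- uniform decay rate `δ/2`.
  set δ := ((x + y) ^ 2).re / 2 with hδ
  have hδ0 : 0 < δ := by positivity
  have hnhds : {z : ℂ | δ < ((z + y) ^ 2).re} ∩ Metric.ball x 1 ∈ 𝓝 x := by
    refine inter_mem ?_ (Metric.ball_mem_nhds x one_pos)
    have hc : Continuous fun z : ℂ => ((z + y) ^ 2).re := by fun_prop
    exact hc.continuousAt.eventually (lt_mem_nhds (by linarith))
  have i1 := hg.ofReal_mul.integrableOn_mul_laplaceKernel hxy
  have i2 := hg.sqrt_mul.integrableOn_mul_laplaceKernel hxy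
  have key := (hasDerivAt_integral_of_dominated_loc_of_deriv_le
    (μ := volume.restrict (Ioi (0 : ℝ))) (x₀ := x)
    (F := fun x t => g t * laplaceKernel x y t)
    (F' := fun x t => g t * ((-x * t - y * (Real.sqrt (t * (t + 1)) : ℂ)) * laplaceKernel x y t))
    (bound := fun t => Real.exp ((‖x‖ + 1) * ‖y‖) *
      ((‖x‖ + 1) * (‖(t : ℂ) * g t‖ * Real.exp (-(δ / 2) * t)) +
        ‖y‖ * (‖(Real.sqrt (t * (t + 1)) : ℂ) * g t‖ * Real.exp (-(δ / 2) * t))))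
    hnhds
    (Eventually.of_forall fun z => Measurable.aestronglyMeasurable (by fun_prop))
    (hg.integrableOn_mul_laplaceKernel hxy)
    (Measurable.aestronglyMeasurable (by fun_prop)) ?_
    ((((hg.ofReal_mul.integrableOn _ (by positivity)).const_mul _).add
      ((hg.sqrt_mul.integrableOn _ (by positivity)).const_mul _)).const_mul _)
    (Eventually.of_forall fun t z _ => (hasDerivAt_laplaceKernel_left z y t).const_mul _)).2
  · refine key.congr_deriv ?_
    rw [weightedLaplace, weightedLaplace, ← integral_const_mul, ← integral_const_mul,
      ← integral_sub (i1.const_mul _) (i2.const_mul _)]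
    congr 1
    ext t
    ring
  · refine (ae_restrict_iff' measurableSet_Ioi).2 (Eventually.of_forall fun t ht z hz => ?_)
    have ht0 : 0 < t := ht
    have hz1 : ‖z‖ ≤ ‖x‖ + 1 := by
      have := mem_ball_iff_norm.1 hz.2
      have h2 := norm_le_norm_add_norm_sub x z
      rw [norm_sub_rev] at h2
      linarith
    have hz2 : δ < ((z + y) ^ 2).re := hz.1
    have hk : ‖laplaceKernel z y t‖ ≤
        Real.exp ((‖x‖ + 1) * ‖y‖) * Real.exp (-(δ / 2) * t) := by
      refine (norm_laplaceKernel_le' z y ht0.le).trans ?_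
      gcongr
    have hl : ‖-z * t - y * (Real.sqrt (t * (t + 1)) : ℂ)‖ ≤
        (‖x‖ + 1) * ‖(t : ℂ)‖ + ‖y‖ * ‖(Real.sqrt (t * (t + 1)) : ℂ)‖ := by
      refine (norm_sub_le _ _).trans ?_
      rw [norm_mul, norm_mul, norm_neg]
      gcongr
    calc _ ≤ ‖g t‖ * (((‖x‖ + 1) * ‖(t : ℂ)‖ + ‖y‖ * ‖(Real.sqrt (t * (t + 1)) : ℂ)‖) *
          (Real.exp ((‖x‖ + 1) * ‖y‖) * Real.exp (-(δ / 2) * t))) := by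
          rw [norm_mul, norm_mul]
          gcongr
      _ = _ := by
          simp only [norm_mul]
          ring

/-! ### The differential equation of the Laplace integral -/

/-- The algebraic weight `t^(ν/2-1) (1+t)^(-(ν+1)/2)`. -/
noncomputable def laplaceWeight (ν : ℂ) (t : ℝ) : ℂ :=
  (t : ℂ) ^ (ν / 2 - 1) * (1 + (t : ℂ)) ^ (-(ν + 1) / 2)

theorem norm_one_add_ofReal_cpow_le_one {ν : ℂ} (hν : 0 < ν.re) {t : ℝ} (ht : 0 ≤ t) :
    ‖(1 + (t : ℂ)) ^ (-(ν + 1) / 2)‖ ≤ 1 := by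
  rw [← Complex.ofReal_one, ← Complex.ofReal_add,
    Complex.norm_cpow_eq_rpow_re_of_pos (by linarith)]
  refine Real.rpow_le_one_of_one_le_of_nonpos (by linarith) ?_
  rw [Complex.ofReal_one, Complex.div_ofNat_re, Complex.neg_re, Complex.add_re, Complex.one_re]
  linarith

theorem isTemperedWeight_laplaceWeight {ν : ℂ} (hν : 0 < ν.re) :
    IsTemperedWeight (laplaceWeight ν) := by
  have hm : Measurable (laplaceWeight ν) := by
    unfold laplaceWeight
    fun_prop
  refine ⟨hm, fun δ hδ => ?_⟩
  have hb := integrableOn_rpow_mul_exp_neg_mul_rpow (p := 1) (s := ν.re / 2 - 1) (b := δ)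
    (by linarith) one_pos hδ
  simp only [Real.rpow_one] at hb
  refine Integrable.mono' hb (Measurable.aestronglyMeasurable (by fun_prop)) ?_
  refine (ae_restrict_iff' measurableSet_Ioi).2 (Eventually.of_forall fun t ht => ?_)
  have ht0 : 0 < t := ht
  rw [Real.norm_of_nonneg (by positivity)]
  refine mul_le_mul_of_nonneg_right ?_ (Real.exp_pos _).le
  rw [laplaceWeight, norm_mul, Complex.norm_cpow_eq_rpow_re_of_pos ht0, Complex.sub_re,
    Complex.div_ofNat_re, Complex.one_re]
  exact mul_le_of_le_one_right (by positivity) (norm_one_add_ofReal_cpow_le_one hν ht0.le)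

theorem hasDerivAt_mul_laplaceWeight {ν : ℂ} (hν : ν ≠ 0) {t : ℝ} (ht : 0 < t) :
    HasDerivAt (fun t : ℝ => (t : ℂ) ^ (ν / 2) * (1 + (t : ℂ)) ^ ((1 - ν) / 2))
      ((ν + t) / 2 * laplaceWeight ν t) t := by
  have ht0 : (t : ℂ) ≠ 0 := Complex.ofReal_ne_zero.2 ht.ne'
  have ht1 : (1 + (t : ℂ)) ≠ 0 := by
    rw [← Complex.ofReal_one, ← Complex.ofReal_add]
    exact Complex.ofReal_ne_zero.2 (by positivity)
  have h1 : HasDerivAt (fun t : ℝ => (t : ℂ) ^ (ν / 2)) (ν / 2 * (t : ℂ) ^ (ν / 2 - 1)) t :=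
    hasDerivAt_ofReal_cpow_const ht.ne' (div_ne_zero hν two_ne_zero)
  have h2 : HasDerivAt (fun t : ℝ => (1 + (t : ℂ)) ^ ((1 - ν) / 2))
      ((1 - ν) / 2 * (1 + (t : ℂ)) ^ ((1 - ν) / 2 - 1)) t := by
    have h3 : HasDerivAt (fun z : ℂ => (1 + z) ^ ((1 - ν) / 2))
        ((1 - ν) / 2 * (1 + (t : ℂ)) ^ ((1 - ν) / 2 - 1) * 1) t := by
      refine ((hasDerivAt_id' (t : ℂ)).const_add 1).cpow_const (Or.inl ?_)
      rw [Complex.add_re, Complex.one_re, Complex.ofReal_re]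
      positivity
    simpa using h3.comp_ofReal
  refine (h1.mul h2).congr_deriv ?_
  rw [laplaceWeight, show (1 - ν) / 2 - 1 = -(ν + 1) / 2 by ring,
    show (1 - ν) / 2 = -(ν + 1) / 2 + 1 by ring, Complex.cpow_add _ _ ht1, Complex.cpow_one,
    show (t : ℂ) ^ (ν / 2) = (t : ℂ) ^ (ν / 2 - 1 + 1) by ring_nf, Complex.cpow_add _ 1 ht0,
    Complex.cpow_one]
  ring

theorem hasDerivAt_laplaceKernel (x y : ℂ) {t : ℝ} (ht : 0 < t) :
    HasDerivAt (laplaceKernel x y)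
      ((-((x ^ 2 + y ^ 2) / 2) - x * y * ((2 * t + 1) / (2 * Real.sqrt (t * (t + 1))) : ℝ)) *
        laplaceKernel x y t) t := by
  have h1 : HasDerivAt (fun t : ℝ => Real.sqrt (t * (t + 1)))
      ((2 * t + 1) / (2 * Real.sqrt (t * (t + 1)))) t := by
    have h2 := ((hasDerivAt_id' t).mul ((hasDerivAt_id' t).add_const 1)).sqrt
      (ne_of_gt (by positivity : 0 < t * (t + 1)))
    refine h2.congr_deriv ?_
    congr 1
    ring
  have h3 : HasDerivAt (fun t : ℝ => -((x ^ 2 + y ^ 2) / 2) * (t : ℂ)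
      - x * y * (Real.sqrt (t * (t + 1)) : ℂ)) _ t :=
    ((hasDerivAt_id' t).ofReal_comp.const_mul (-((x ^ 2 + y ^ 2) / 2))).sub
      (h1.ofReal_comp.const_mul (x * y))
  refine h3.cexp.congr_deriv ?_
  rw [mul_comm]
  simp [laplaceKernel]

/-- The combined integrand is the derivative of `-2 t(1+t)` times weight times kernel, which
vanishes at both ends. This is what closes the second-order equation in `x`. -/
theorem weightedLaplace_relation {ν : ℂ} (hν : 0 < ν.re) {x y : ℂ}
    (hxy : 0 < ((x + y) ^ 2).re) :
    (x ^ 2 + y ^ 2) * weightedLaplace (fun t => (t : ℂ) * ((t : ℂ) * laplaceWeight ν t)) x y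
    + 2 * x * y * weightedLaplace
        (fun t => (t : ℂ) * ((Real.sqrt (t * (t + 1)) : ℂ) * laplaceWeight ν t)) x y
    + (x ^ 2 + y ^ 2 - 1) * weightedLaplace (fun t => (t : ℂ) * laplaceWeight ν t) x y
    + x * y * weightedLaplace (fun t => (Real.sqrt (t * (t + 1)) : ℂ) * laplaceWeight ν t) x y
    - ν * weightedLaplace (laplaceWeight ν) x y = 0 := by
  have hν0 : ν ≠ 0 := by rintro rfl; simp at hν
  have hw := isTemperedWeight_laplaceWeight hν
  have i1 := (hw.ofReal_mul.ofReal_mul.integrableOn_mul_laplaceKernel hxy).const_mul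
    (x ^ 2 + y ^ 2)
  have i2 := (hw.sqrt_mul.ofReal_mul.integrableOn_mul_laplaceKernel hxy).const_mul (2 * x * y)
  have i3 := (hw.ofReal_mul.integrableOn_mul_laplaceKernel hxy).const_mul (x ^ 2 + y ^ 2 - 1)
  have i4 := (hw.sqrt_mul.integrableOn_mul_laplaceKernel hxy).const_mul (x * y)
  have i5 := (hw.integrableOn_mul_laplaceKernel hxy).const_mul ν
  have i12 := i1.add i2
  have i123 := i12.add i3
  have i1234 := i123.add i4
  have i := i1234.sub i5
  set f : ℝ → ℂ := fun t =>
    -2 * ((t : ℂ) ^ (ν / 2) * (1 + (t : ℂ)) ^ ((1 - ν) / 2) * laplaceKernel x y t)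
  have hsplit : ∀ t : ℝ, 0 < t → (t : ℂ) ^ (ν / 2) * (1 + (t : ℂ)) ^ ((1 - ν) / 2) =
      (t : ℂ) * (1 + t) * laplaceWeight ν t := by
    intro t ht
    have ht0 : (t : ℂ) ≠ 0 := Complex.ofReal_ne_zero.2 ht.ne'
    have ht1 : (1 + (t : ℂ)) ≠ 0 := by
      rw [← Complex.ofReal_one, ← Complex.ofReal_add]
      exact Complex.ofReal_ne_zero.2 (by positivity)
    rw [laplaceWeight, show (1 - ν) / 2 = -(ν + 1) / 2 + 1 by ring, Complex.cpow_add _ _ ht1,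
      Complex.cpow_one, show (t : ℂ) ^ (ν / 2) = (t : ℂ) ^ (ν / 2 - 1 + 1) by ring_nf,
      Complex.cpow_add _ 1 ht0, Complex.cpow_one]
    ring
  have hf : IntegrableOn f (Ioi 0) := by
    have j := ((hw.ofReal_mul.integrableOn_mul_laplaceKernel hxy).add
      (hw.ofReal_mul.ofReal_mul.integrableOn_mul_laplaceKernel hxy)).const_mul (-2)
    refine IntegrableOn.congr_fun j (fun t ht => ?_) measurableSet_Ioi
    simp only [f, hsplit t ht, Pi.add_apply]
    ring
  have hd : ∀ t ∈ Ioi (0 : ℝ), HasDerivAt f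
      ((x ^ 2 + y ^ 2) * ((t : ℂ) * ((t : ℂ) * laplaceWeight ν t) * laplaceKernel x y t)
      + 2 * x * y *
        ((t : ℂ) * ((Real.sqrt (t * (t + 1)) : ℂ) * laplaceWeight ν t) * laplaceKernel x y t)
      + (x ^ 2 + y ^ 2 - 1) * ((t : ℂ) * laplaceWeight ν t * laplaceKernel x y t)
      + x * y * ((Real.sqrt (t * (t + 1)) : ℂ) * laplaceWeight ν t * laplaceKernel x y t)
      - ν * (laplaceWeight ν t * laplaceKernel x y t)) t := by
    intro t ht
    have ht0 : 0 < t := ht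
    refine (((hasDerivAt_mul_laplaceWeight hν0 ht).mul
      (hasDerivAt_laplaceKernel x y ht)).const_mul (-2)).congr_deriv ?_
    rw [hsplit t ht]
    have hR : 0 < Real.sqrt (t * (t + 1)) := Real.sqrt_pos.2 (by positivity)
    have hR0 : (Real.sqrt (t * (t + 1)) : ℂ) ≠ 0 := Complex.ofReal_ne_zero.2 hR.ne'
    have hR2 : (Real.sqrt (t * (t + 1)) : ℂ) ^ 2 = t * (t + 1) := by
      rw [← Complex.ofReal_pow, Real.sq_sqrt (by positivity)]
      push_cast
      ring
    push_cast
    generalize (Real.sqrt (t * (t + 1)) : ℂ) = r at hR0 hR2 ⊢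
    generalize laplaceWeight ν t = w
    generalize laplaceKernel x y t = k
    -- The factor `t(1+t)` cancels the singular denominator `√(t(t+1))` from differentiating the
    -- kernel.
    have h3 : (t : ℂ) * (1 + t) / r = r := by
      field_simp
      linear_combination -hR2
    linear_combination (x * y * (2 * t + 1) * w * k) * h3
  have key := integral_Ioi_of_hasDerivAt_of_tendsto (f := f) ?_ hd i
    (tendsto_zero_of_hasDerivAt_of_integrableOn_Ioi hd i hf)
  · have h0 : f 0 = 0 := by
      simp [f, Complex.zero_cpow (div_ne_zero hν0 two_ne_zero)]
    rw [h0, sub_zero] at key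
    have key' := (integral_sub' i1234 i5).symm.trans key
    rw [integral_add' i123 i4, integral_add' i12 i3, integral_add' i1 i2, integral_const_mul,
      integral_const_mul, integral_const_mul, integral_const_mul, integral_const_mul] at key'
    exact key'
  · refine ContinuousAt.continuousWithinAt (continuousAt_const.mul
      (ContinuousAt.mul (ContinuousAt.mul ?_ ?_) ?_))
    · refine Complex.continuousAt_ofReal_cpow_const _ _ (Or.inl ?_)
      rw [Complex.div_ofNat_re]
      positivity
    · exact ContinuousAt.cpow (by fun_prop) continuousAt_const (by simp)
    · unfold laplaceKernel
      fun_prop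

/-- The derivative in `x` of the Laplace integral `weightedLaplace (laplaceWeight ν) x y`. -/
noncomputable def laplaceDeriv (ν x y : ℂ) : ℂ :=
  -x * weightedLaplace (fun t => (t : ℂ) * laplaceWeight ν t) x y
    - y * weightedLaplace (fun t => (Real.sqrt (t * (t + 1)) : ℂ) * laplaceWeight ν t) x y

/-- This is `F'' = x F' + ν F`. Two derivatives yield moments with `t²`, `t√(t(t+1))` and `t(t+1)`;
the last splits as `t² + t`, and `weightedLaplace_relation` eliminates the quadratic moments. -/
theorem hasDerivAt_laplaceDeriv {ν : ℂ} (hν : 0 < ν.re) {x y : ℂ}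
    (hxy : 0 < ((x + y) ^ 2).re) :
    HasDerivAt (fun x => laplaceDeriv ν x y)
      (x * laplaceDeriv ν x y + ν * weightedLaplace (laplaceWeight ν) x y) x := by
  have hw := isTemperedWeight_laplaceWeight hν
  have h := ((hasDerivAt_id' x).fun_neg.mul (hw.ofReal_mul.hasDerivAt_weightedLaplace hxy)).sub
    ((hw.sqrt_mul.hasDerivAt_weightedLaplace hxy).const_mul y)
  refine h.congr_deriv ?_
  have h1 : weightedLaplace
      (fun t => (Real.sqrt (t * (t + 1)) : ℂ) * ((t : ℂ) * laplaceWeight ν t)) x y =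
      weightedLaplace
      (fun t => (t : ℂ) * ((Real.sqrt (t * (t + 1)) : ℂ) * laplaceWeight ν t)) x y := by
    simp only [mul_left_comm]
  have h2 : weightedLaplace (fun t => (Real.sqrt (t * (t + 1)) : ℂ) *
      ((Real.sqrt (t * (t + 1)) : ℂ) * laplaceWeight ν t)) x y =
      weightedLaplace (fun t => (t : ℂ) * ((t : ℂ) * laplaceWeight ν t)) x y +
      weightedLaplace (fun t => (t : ℂ) * laplaceWeight ν t) x y := by
    simp only [weightedLaplace]
    rw [← integral_add (hw.ofReal_mul.ofReal_mul.integrableOn_mul_laplaceKernel hxy)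
      (hw.ofReal_mul.integrableOn_mul_laplaceKernel hxy)]
    refine setIntegral_congr_fun measurableSet_Ioi fun t ht => ?_
    have ht0 : 0 < t := ht
    have hR2 : (Real.sqrt (t * (t + 1)) : ℂ) ^ 2 = t * (t + 1) := by
      rw [← Complex.ofReal_pow, Real.sq_sqrt (by positivity)]
      push_cast
      ring
    linear_combination (laplaceWeight ν t * laplaceKernel x y t) * hR2
  have h3 := weightedLaplace_relation hν hxy
  rw [h1, h2, laplaceDeriv]
  linear_combination h3

/-! ### Asymptotics of the Laplace integral -/

theorem re_sq_add_ofReal (w : ℂ) (τ : ℝ) :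
    ((w + τ) ^ 2).re = (w ^ 2).re + 2 * τ * w.re + τ ^ 2 := by
  simp only [sq, Complex.mul_re, Complex.add_re, Complex.add_im, Complex.ofReal_re,
    Complex.ofReal_im]
  ring

theorem cpow_mul_weightedLaplace (ν x y : ℂ) {τ : ℝ} (hτ : 0 < τ) :
    (τ : ℂ) ^ ν * weightedLaplace (laplaceWeight ν) x y = ∫ v in Ioi (0 : ℝ),
      2 * (v : ℂ) ^ (ν - 1) * (1 + (((v / τ) ^ 2 : ℝ) : ℂ)) ^ (-(ν + 1) / 2) *
        laplaceKernel x y ((v / τ) ^ 2) := by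
  have h := integral_comp_mul_left_Ioi
    (fun s : ℝ => (2 * s ^ ((2 : ℝ) - 1)) • (laplaceWeight ν (s ^ (2 : ℝ)) *
      laplaceKernel x y (s ^ (2 : ℝ)))) 0 (inv_pos.2 hτ)
  rw [mul_zero, inv_inv, integral_comp_rpow_Ioi_of_pos (g := fun t => laplaceWeight ν t *
      laplaceKernel x y t) two_pos] at h
  have hτ0 : (τ : ℂ) ≠ 0 := Complex.ofReal_ne_zero.2 hτ.ne'
  have h1 : (τ : ℂ) ^ ν * weightedLaplace (laplaceWeight ν) x y = (τ : ℂ) ^ (ν - 1) *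
      (τ • ∫ t in Ioi (0 : ℝ), laplaceWeight ν t * laplaceKernel x y t) := by
    rw [Complex.real_smul, ← mul_assoc, Complex.cpow_sub _ _ hτ0, Complex.cpow_one,
      div_mul_cancel₀ _ hτ0]
    rfl
  rw [h1, ← h, ← integral_const_mul]
  refine setIntegral_congr_fun measurableSet_Ioi fun v hv => ?_
  have hv0 : 0 < v := hv
  have hs0 : 0 < v / τ := by positivity
  have hsc : ((v / τ : ℝ) : ℂ) ≠ 0 := Complex.ofReal_ne_zero.2 hs0.ne'
  have h2 : (τ : ℂ) ^ (ν - 1) * ((v / τ : ℝ) : ℂ) ^ (ν - 1) = (v : ℂ) ^ (ν - 1) := by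
    rw [← Complex.mul_cpow_ofReal_nonneg hτ.le hs0.le, ← Complex.ofReal_mul,
      mul_div_cancel₀ _ hτ.ne']
  have h3 : (((v / τ) ^ 2 : ℝ) : ℂ) ^ (ν / 2 - 1) * ((v / τ : ℝ) : ℂ) =
      ((v / τ : ℝ) : ℂ) ^ (ν - 1) := by
    rw [sq, Complex.ofReal_mul, Complex.mul_cpow_ofReal_nonneg hs0.le hs0.le,
      ← Complex.cpow_add _ _ hsc]
    nth_rw 2 [← Complex.cpow_one ((v / τ : ℝ) : ℂ)]
    rw [← Complex.cpow_add _ _ hsc]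
    congr 1
    ring
  have h4 : τ⁻¹ * v = v / τ := by ring
  simp only [h4, Real.rpow_two, show (2 : ℝ) - 1 = 1 by norm_num, Real.rpow_one, laplaceWeight,
    Complex.real_smul]
  rw [← h2, ← h3]
  push_cast
  ring

/-- With `t = (v/τ)²` the quadratic part of the exponent tends to `-v²/2` and the cross term to
`-yv`, since `√(t(t+1)) ~ v/τ`; the algebraic factor tends to `1`. The `2` is the Jacobian of
squaring. -/
theorem tendsto_cpow_mul_weightedLaplace {ν : ℂ} (hν : 0 < ν.re) {x y : ℂ}
    (hre : 0 < (x + y).re) (hxy : 0 < ((x + y) ^ 2).re) :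
    Tendsto (fun τ : ℝ => (τ : ℂ) ^ ν * weightedLaplace (laplaceWeight ν) (x + τ) y) atTop
      (𝓝 (2 * parabolicIntegral ν y)) := by
  rw [parabolicIntegral, ← integral_const_mul]
  refine Tendsto.congr' (f₁ := fun τ : ℝ => ∫ v in Ioi (0 : ℝ),
      2 * (v : ℂ) ^ (ν - 1) * (1 + (((v / τ) ^ 2 : ℝ) : ℂ)) ^ (-(ν + 1) / 2) *
        laplaceKernel (x + τ) y ((v / τ) ^ 2)) ?_
    (tendsto_integral_filter_of_dominated_convergence _ ?_ ?_
      ((integrableOn_rpow_mul_exp_linear_sub_sq hν (2 * ‖y‖)).const_mul 2) ?_)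
  · filter_upwards [eventually_gt_atTop 0] with τ hτ
    exact (cpow_mul_weightedLaplace ν _ _ hτ).symm
  · exact Eventually.of_forall fun τ => Measurable.aestronglyMeasurable (by fun_prop)
  · filter_upwards [eventually_gt_atTop 0, eventually_ge_atTop ‖x‖] with τ hτ hτx
    refine (ae_restrict_iff' measurableSet_Ioi).2 (Eventually.of_forall fun v hv => ?_)
    have hv0 : 0 < v := hv
    have hs0 : 0 < v / τ := by positivity
    have hsq : 0 ≤ (v / τ) ^ 2 := by positivity
    have hnorm : ‖x + τ‖ ≤ 2 * τ := by
      refine (norm_add_le _ _).trans ?_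
      rw [Complex.norm_real, Real.norm_of_nonneg hτ.le]
      linarith
    have hk : ‖laplaceKernel (x + τ) y ((v / τ) ^ 2)‖ ≤
        Real.exp (2 * ‖y‖ * v - v ^ 2 / 2) := by
      refine (norm_laplaceKernel_le _ _ hsq).trans (Real.exp_le_exp.2 ?_)
      have h1 := sqrt_mul_add_one_le_add_sqrt hsq
      rw [Real.sqrt_sq hs0.le] at h1
      have h2 := le_sqrt_mul_add_one hsq
      have h3 : ‖x + τ‖ * ‖y‖ *
          (Real.sqrt ((v / τ) ^ 2 * ((v / τ) ^ 2 + 1)) - (v / τ) ^ 2) ≤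
          (2 * τ) * ‖y‖ * (v / τ) := by
        gcongr
        linarith
      have h4 : (2 * τ) * ‖y‖ * (v / τ) = 2 * ‖y‖ * v := by field_simp
      have h5 : v ^ 2 / 2 ≤ ((x + τ + y) ^ 2).re / 2 * (v / τ) ^ 2 := by
        have h6 : v ^ 2 / 2 = τ ^ 2 / 2 * (v / τ) ^ 2 := by field_simp
        rw [h6, add_right_comm, re_sq_add_ofReal]
        gcongr
        have : 0 ≤ 2 * τ * (x + y).re := by positivity
        linarith
      linarith
    rw [norm_mul, norm_mul, norm_mul, Complex.norm_cpow_eq_rpow_re_of_pos hv0, Complex.sub_re,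
      Complex.one_re, Complex.norm_ofNat, mul_assoc 2, mul_assoc 2]
    refine mul_le_mul_of_nonneg_left (mul_le_mul ?_ hk (norm_nonneg _) (by positivity)) two_pos.le
    exact mul_le_of_le_one_right (by positivity) (norm_one_add_ofReal_cpow_le_one hν hsq)
  · refine (ae_restrict_iff' measurableSet_Ioi).2 (Eventually.of_forall fun v hv => ?_)
    have hv0 : 0 < v := hv
    have hs : Tendsto (fun τ : ℝ => v / τ) atTop (𝓝 0) := by
      simpa [div_eq_mul_inv] using (tendsto_inv_atTop_zero (𝕜 := ℝ)).const_mul v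
    have hsc : Tendsto (fun τ : ℝ => ((v / τ : ℝ) : ℂ)) atTop (𝓝 0) := by
      simpa using hs.ofReal
    have hw : Tendsto (fun τ : ℝ => (1 + (((v / τ) ^ 2 : ℝ) : ℂ)) ^ (-(ν + 1) / 2)) atTop
        (𝓝 1) := by
      have hc : ContinuousAt (fun s : ℝ => (1 + ((s ^ 2 : ℝ) : ℂ)) ^ (-(ν + 1) / 2)) 0 :=
        ContinuousAt.cpow (by fun_prop) continuousAt_const (by simp)
      have := hc.tendsto.comp hs
      simpa [Function.comp_def] using this
    have hq : Tendsto (fun τ : ℝ => (Real.sqrt ((v / τ) ^ 2 + 1) : ℂ)) atTop (𝓝 1) := by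
      have hc : ContinuousAt (fun s : ℝ => (Real.sqrt (s ^ 2 + 1) : ℂ)) 0 := by fun_prop
      have := hc.tendsto.comp hs
      simpa [Function.comp_def] using this
    have hx : Tendsto (fun τ : ℝ => x * ((v / τ : ℝ) : ℂ) + v) atTop (𝓝 v) := by
      simpa using (hsc.const_mul x).add_const (v : ℂ)
    have hk : Tendsto (fun τ : ℝ => laplaceKernel (x + τ) y ((v / τ) ^ 2)) atTop
        (𝓝 (Complex.exp (-y * v - (v : ℂ) ^ 2 / 2))) := by
      refine (Complex.continuous_exp.tendsto _).comp ?_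
      have h1 := (((hx.pow 2).add ((hsc.const_mul y).pow 2)).div_const 2).neg.sub
        ((hx.mul hq).mul_const y)
      have h2 : -(((v : ℂ) ^ 2 + (y * 0) ^ 2) / 2) - v * 1 * y = -y * v - (v : ℂ) ^ 2 / 2 := by
        ring
      rw [h2] at h1
      refine h1.congr' ?_
      filter_upwards [eventually_gt_atTop 0] with τ hτ
      have hτ0 : (τ : ℂ) ≠ 0 := Complex.ofReal_ne_zero.2 hτ.ne'
      rw [Real.sqrt_mul (sq_nonneg _), Real.sqrt_sq (by positivity)]
      push_cast
      field_simp
    have h := ((hw.const_mul (2 * (v : ℂ) ^ (ν - 1))).mul hk)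
    rw [mul_one, mul_assoc] at h
    exact h

/-! ### Proportionality of the two solutions on the sector -/

/-- The set of `x` with `x + y` in the open sector `|arg| < π/4`. -/
def shiftedSector (y : ℂ) : Set ℂ :=
  {x | |(x + y).im| < (x + y).re}

theorem mem_shiftedSector_iff {x y : ℂ} :
    x ∈ shiftedSector y ↔ 0 < (x + y).re ∧ 0 < ((x + y) ^ 2).re := by
  have h : ((x + y) ^ 2).re = (x + y).re ^ 2 - (x + y).im ^ 2 := by
    rw [sq, Complex.mul_re]; ring
  rw [shiftedSector, mem_ofPred_eq, h, sub_pos]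
  constructor
  · intro hx
    have h0 := (abs_nonneg _).trans_lt hx
    exact ⟨h0, sq_lt_sq.2 (by rwa [abs_of_pos h0])⟩
  · rintro ⟨h1, h2⟩
    have := sq_lt_sq.1 h2
    rwa [abs_of_pos h1] at this

theorem isOpen_shiftedSector (y : ℂ) : IsOpen (shiftedSector y) :=
  isOpen_lt (by fun_prop) (by fun_prop)

theorem isPreconnected_shiftedSector (y : ℂ) : IsPreconnected (shiftedSector y) := by
  refine Convex.isPreconnected fun u hu v hv a b ha hb hab => ?_
  simp only [shiftedSector, mem_ofPred_eq, abs_lt] at hu hv ⊢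
  have e1 : (a • u + b • v + y).re = a * (u + y).re + b * (v + y).re := by
    simp only [Complex.add_re, Complex.real_smul, Complex.re_ofReal_mul]
    linear_combination (-y.re) * hab
  have e2 : (a • u + b • v + y).im = a * (u + y).im + b * (v + y).im := by
    simp only [Complex.add_im, Complex.real_smul, Complex.im_ofReal_mul]
    linear_combination (-y.im) * hab
  rw [e1, e2]
  rcases ha.eq_or_lt with rfl | ha
  · have : b = 1 := by linarith
    subst this
    simpa using hv
  · constructor
    · nlinarith [mul_lt_mul_of_pos_left hu.1 ha, mul_le_mul_of_nonneg_left hv.1.le hb]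
    · nlinarith [mul_lt_mul_of_pos_left hu.2 ha, mul_le_mul_of_nonneg_left hv.2.le hb]

theorem add_ofReal_mem_shiftedSector {x y : ℂ} (hx : x ∈ shiftedSector y) {τ : ℝ} (hτ : 0 ≤ τ) :
    x + τ ∈ shiftedSector y := by
  simp only [shiftedSector, mem_ofPred_eq, Complex.add_im, Complex.add_re, Complex.ofReal_im,
    Complex.ofReal_re, add_zero] at hx ⊢
  linarith

/-- Abel's identity: the Wronskian of two solutions of `f'' = z f' + ν f` satisfies `W' = z W`,
which the factor `e^(-z²/2)` compensates. -/
theorem hasDerivAt_wronskian {ν : ℂ} (hν : 0 < ν.re) {y z : ℂ} (hz : z ∈ shiftedSector y) :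
    HasDerivAt (fun z => (weightedLaplace (laplaceWeight ν) z y * -parabolicIntegral (ν + 1) z
      - laplaceDeriv ν z y * parabolicIntegral ν z) * Complex.exp (-z ^ 2 / 2)) 0 z := by
  have hxy := (mem_shiftedSector_iff.1 hz).2
  have hν1 : 0 < (ν + 1).re := by rw [Complex.add_re, Complex.one_re]; positivity
  have hF := (isTemperedWeight_laplaceWeight hν).hasDerivAt_weightedLaplace hxy
  have hF1 := hasDerivAt_laplaceDeriv hν hxy
  have hG := hasDerivAt_parabolicIntegral hν z
  have hG1 := hasDerivAt_parabolicIntegral hν1 z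
  have he : HasDerivAt (fun z : ℂ => -z ^ 2 / 2) (-z) z := by
    refine ((hasDerivAt_pow 2 z).fun_neg.div_const 2).congr_deriv ?_
    push_cast
    ring
  refine (((hF.mul hG1.fun_neg).sub (hF1.mul hG)).mul he.cexp).congr_deriv ?_
  have hrec := parabolicIntegral_add_two hν z
  rw [show ν + 2 = ν + 1 + 1 by ring] at hrec
  simp only [Pi.sub_apply, Pi.mul_apply]
  rw [hrec, laplaceDeriv]
  ring

/-- The weighted Wronskian is constant on the connected sector, which contains the ray `x + τ`.
There the Wronskian is at most exponential in `τ`, while `e^(-z²/2)` is of size `e^(-τ²/2 + O(τ))`.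
-/
theorem wronskian_eq_zero {ν : ℂ} (hν : 0 < ν.re) {x y : ℂ} (hx : x ∈ shiftedSector y) :
    weightedLaplace (laplaceWeight ν) x y * -parabolicIntegral (ν + 1) x
      - laplaceDeriv ν x y * parabolicIntegral ν x = 0 := by
  set Φ : ℂ → ℂ := fun z =>
    (weightedLaplace (laplaceWeight ν) z y * -parabolicIntegral (ν + 1) z
      - laplaceDeriv ν z y * parabolicIntegral ν z) * Complex.exp (-z ^ 2 / 2) with hΦ
  have hconst : ∀ τ : ℝ, 0 ≤ τ → Φ (x + τ) = Φ x := fun τ hτ =>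
    (isOpen_shiftedSector y).is_const_of_deriv_eq_zero (isPreconnected_shiftedSector y)
      (fun z hz => (hasDerivAt_wronskian hν hz).differentiableAt.differentiableWithinAt)
      (fun z hz => (hasDerivAt_wronskian hν hz).deriv)
      (add_ofReal_mem_shiftedSector hx hτ) hx
  have hν1 : 0 < (ν + 1).re := by rw [Complex.add_re, Complex.one_re]; positivity
  obtain ⟨hre, hsq⟩ := mem_shiftedSector_iff.1 hx
  have hw := isTemperedWeight_laplaceWeight hν
  obtain ⟨C0, h0⟩ := hw.norm_weightedLaplace_le hsq y
  obtain ⟨C1, h1⟩ := hw.ofReal_mul.norm_weightedLaplace_le hsq y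
  obtain ⟨C2, h2⟩ := hw.sqrt_mul.norm_weightedLaplace_le hsq y
  obtain ⟨D0, g0⟩ := norm_parabolicIntegral_add_le hν x
  obtain ⟨D1, g1⟩ := norm_parabolicIntegral_add_le hν1 x
  have hbound : ∀ τ : ℝ, 0 ≤ τ → ‖Φ (x + τ)‖ ≤
      (|C0| * |D1| + (|C1| + ‖y‖ * |C2|) * |D0|) *
        Real.exp ((‖y‖ + 1) * (‖x‖ + τ) + (‖x‖ ^ 2 / 2 + τ * ‖x‖ - τ ^ 2 / 2)) := by
    intro τ hτ
    have hz : ((x + y) ^ 2).re ≤ ((x + τ + y) ^ 2).re := by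
      rw [add_right_comm, re_sq_add_ofReal]
      have : 0 ≤ 2 * τ * (x + y).re := by positivity
      nlinarith [sq_nonneg τ]
    have hn : ‖x + τ‖ ≤ ‖x‖ + τ := by
      refine (norm_add_le _ _).trans ?_
      rw [Complex.norm_real, Real.norm_of_nonneg hτ]
    have b0 := h0 _ hz
    have b1 := h1 _ hz
    have b2 := h2 _ hz
    have d0 := (g0 τ hτ).trans (le_abs_self _)
    have d1 := (g1 τ hτ).trans (le_abs_self _)
    set E := Real.exp (‖x + τ‖ * ‖y‖) with hE
    have hE0 : 0 < E := Real.exp_pos _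
    -- An extra `e^‖x+τ‖` absorbs the linear factor `x + τ` in `F'`, so that one exponential bounds
    -- both products.
    have hexp : ‖x + τ‖ + 1 ≤ Real.exp ‖x + τ‖ := Real.add_one_le_exp _
    have hone : 1 ≤ Real.exp ‖x + τ‖ := by linarith [norm_nonneg (x + (τ : ℂ))]
    replace b0 : ‖weightedLaplace (laplaceWeight ν) (x + τ) y‖ ≤ |C0| * E :=
      b0.trans (mul_le_mul_of_nonneg_right (le_abs_self _) hE0.le)
    replace b1 := b1.trans (mul_le_mul_of_nonneg_right (le_abs_self C1) hE0.le)
    replace b2 := b2.trans (mul_le_mul_of_nonneg_right (le_abs_self C2) hE0.le)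
    have bd : ‖laplaceDeriv ν (x + τ) y‖ ≤
        (|C1| + ‖y‖ * |C2|) * (E * Real.exp ‖x + τ‖) := by
      refine (norm_sub_le _ _).trans ?_
      rw [norm_mul, norm_mul, norm_neg]
      calc _ ≤ Real.exp ‖x + τ‖ * (|C1| * E) + ‖y‖ * (|C2| * E) * Real.exp ‖x + τ‖ := by
            refine add_le_add (mul_le_mul (by linarith) b1 (norm_nonneg _) (Real.exp_pos _).le) ?_
            refine (mul_le_mul_of_nonneg_left b2 (norm_nonneg _)).trans ?_
            exact le_mul_of_one_le_right (by positivity) hone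
        _ = _ := by ring
    have hg : ‖Complex.exp (-(x + τ) ^ 2 / 2)‖ ≤
        Real.exp (‖x‖ ^ 2 / 2 + τ * ‖x‖ - τ ^ 2 / 2) := by
      rw [Complex.norm_exp, Complex.div_ofNat_re, Complex.neg_re, re_sq_add_ofReal]
      refine Real.exp_le_exp.2 ?_
      have e1 : -‖x‖ ^ 2 ≤ (x ^ 2).re := by
        rw [← norm_pow]
        exact (abs_le.1 (Complex.abs_re_le_norm _)).1
      have e2 : -‖x‖ ≤ x.re := (abs_le.1 (Complex.abs_re_le_norm _)).1
      nlinarith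
    have hW : ‖weightedLaplace (laplaceWeight ν) (x + τ) y * -parabolicIntegral (ν + 1) (x + τ)
        - laplaceDeriv ν (x + τ) y * parabolicIntegral ν (x + τ)‖ ≤
        (|C0| * |D1| + (|C1| + ‖y‖ * |C2|) * |D0|) * (E * Real.exp ‖x + τ‖) := by
      refine (norm_sub_le _ _).trans ?_
      rw [norm_mul, norm_mul, norm_neg]
      calc _ ≤ (|C0| * E) * |D1| * Real.exp ‖x + τ‖ +
            ((|C1| + ‖y‖ * |C2|) * (E * Real.exp ‖x + τ‖)) * |D0| := by
            refine add_le_add ?_ (mul_le_mul bd d0 (norm_nonneg _) (by positivity))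
            refine (mul_le_mul b0 d1 (norm_nonneg _) (by positivity)).trans ?_
            exact le_mul_of_one_le_right (by positivity) hone
        _ = _ := by ring
    have hEE : E * Real.exp ‖x + τ‖ ≤ Real.exp ((‖y‖ + 1) * (‖x‖ + τ)) := by
      rw [hE, ← Real.exp_add]
      refine Real.exp_le_exp.2 ?_
      nlinarith [norm_nonneg y]
    rw [hΦ, norm_mul, Real.exp_add, ← mul_assoc]
    refine mul_le_mul (hW.trans ?_) hg (norm_nonneg _) (by positivity)
    exact mul_le_mul_of_nonneg_left hEE (by positivity)
  have hlim : Tendsto (fun τ : ℝ => (‖y‖ + 1) * (‖x‖ + τ) +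
      (‖x‖ ^ 2 / 2 + τ * ‖x‖ - τ ^ 2 / 2)) atTop atBot := by
    refine tendsto_atBot_mono' (f₁ := fun τ : ℝ => (‖y‖ + 1) * ‖x‖ + ‖x‖ ^ 2 / 2 - τ) _ ?_ ?_
    · filter_upwards [eventually_ge_atTop (2 * (‖x‖ + ‖y‖ + 2)), eventually_ge_atTop 0] with τ h1 h2
      nlinarith [mul_nonneg h2 (sub_nonneg.2 h1)]
    · exact tendsto_atBot_add_const_left _ _ tendsto_neg_atTop_atBot
  have hzero : Tendsto (fun τ : ℝ => ‖Φ (x + τ)‖) atTop (𝓝 0) := by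
    refine squeeze_zero' (Eventually.of_forall fun _ => norm_nonneg _)
      ((eventually_ge_atTop 0).mono hbound) ?_
    simpa using (Real.tendsto_exp_atBot.comp hlim).const_mul
      (|C0| * |D1| + (|C1| + ‖y‖ * |C2|) * |D0|)
  have hΦx : ‖Φ x‖ = 0 := by
    refine tendsto_nhds_unique (tendsto_const_nhds.congr' ?_) hzero
    filter_upwards [eventually_ge_atTop 0] with τ hτ
    rw [hconst τ hτ]
  exact (mul_eq_zero.1 (norm_eq_zero.1 hΦx)).resolve_right (Complex.exp_ne_zero _)

/-- A vanishing Wronskian makes `F/U` locally constant only where `U ≠ 0`. Far out on the ray this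
holds because `τ^ν U(x+τ)` has the nonzero limit `Γ(ν)`; the limits there fix the constant, and the
identity theorem carries the formula to the whole sector, possible zeros of `U` included. -/
theorem Gamma_mul_weightedLaplace {ν : ℂ} (hν : 0 < ν.re) {x y : ℂ}
    (hx : x ∈ shiftedSector y) :
    Complex.Gamma ν * weightedLaplace (laplaceWeight ν) x y =
      2 * parabolicIntegral ν x * parabolicIntegral ν y := by
  have hΓ := Complex.Gamma_ne_zero_of_re_pos hν
  obtain ⟨hre, hsq⟩ := mem_shiftedSector_iff.1 hx
  have hFlim := tendsto_cpow_mul_weightedLaplace hν hre hsq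
  have hGlim := tendsto_cpow_mul_parabolicIntegral hν x
  obtain ⟨T, hT⟩ := eventually_atTop.1 ((hGlim.eventually_ne hΓ).and (eventually_ge_atTop 0))
  have hT0 : 0 ≤ T := (hT T le_rfl).2
  have hG0 : ∀ τ : ℝ, T ≤ τ → parabolicIntegral ν (x + τ) ≠ 0 := fun τ hτ =>
    right_ne_zero_of_mul (hT τ hτ).1
  set q : ℝ → ℂ := fun τ =>
    weightedLaplace (laplaceWeight ν) (x + τ) y / parabolicIntegral ν (x + τ) with hq
  have hqd : ∀ τ : ℝ, T ≤ τ → HasDerivAt q 0 τ := by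
    intro τ hτ
    have hz := add_ofReal_mem_shiftedSector hx (hT0.trans hτ)
    have hd := ((isTemperedWeight_laplaceWeight hν).hasDerivAt_weightedLaplace
      (mem_shiftedSector_iff.1 hz).2).div (hasDerivAt_parabolicIntegral hν (x + τ)) (hG0 τ hτ)
    have hd' := (hd.comp_const_add x (τ : ℂ)).comp_ofReal
    refine hd'.congr_deriv ?_
    rw [div_eq_zero_iff]
    left
    have hW := wronskian_eq_zero hν hz
    rw [laplaceDeriv] at hW
    linear_combination -hW
  have hqc : ∀ τ : ℝ, T ≤ τ → q τ = q T := fun τ hτ =>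
    constant_of_has_deriv_right_zero (a := T) (b := τ)
      (fun s hs => (hqd s hs.1).continuousAt.continuousWithinAt)
      (fun s hs => (hqd s hs.1).hasDerivWithinAt) τ ⟨hτ, le_rfl⟩
  have hqlim : Tendsto q atTop (𝓝 (2 * parabolicIntegral ν y / Complex.Gamma ν)) := by
    refine (hFlim.div hGlim hΓ).congr' ?_
    filter_upwards [eventually_gt_atTop 0] with τ hτ
    have hτ0 : (τ : ℂ) ^ ν ≠ 0 := by
      rw [Complex.cpow_def_of_ne_zero (Complex.ofReal_ne_zero.2 hτ.ne')]
      exact Complex.exp_ne_zero _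
    exact mul_div_mul_left _ _ hτ0
  have hqT : q T = 2 * parabolicIntegral ν y / Complex.Gamma ν := by
    refine tendsto_nhds_unique (tendsto_const_nhds.congr' ?_) hqlim
    filter_upwards [eventually_ge_atTop T] with τ hτ
    exact (hqc τ hτ).symm
  have heq : ∀ τ : ℝ, T ≤ τ → Complex.Gamma ν * weightedLaplace (laplaceWeight ν) (x + τ) y =
      2 * parabolicIntegral ν (x + τ) * parabolicIntegral ν y := by
    intro τ hτ
    have h := (hqc τ hτ).trans hqT
    rw [hq, div_eq_div_iff (hG0 τ hτ) hΓ] at h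
    linear_combination h
  have hFa : AnalyticOnNhd ℂ
      (fun z => Complex.Gamma ν * weightedLaplace (laplaceWeight ν) z y) (shiftedSector y) :=
    DifferentiableOn.analyticOnNhd (fun z hz =>
      (((isTemperedWeight_laplaceWeight hν).hasDerivAt_weightedLaplace
        (mem_shiftedSector_iff.1 hz).2).differentiableAt.const_mul _).differentiableWithinAt)
      (isOpen_shiftedSector y)
  have hGa : AnalyticOnNhd ℂ
      (fun z => 2 * parabolicIntegral ν z * parabolicIntegral ν y) (shiftedSector y) :=
    DifferentiableOn.analyticOnNhd (fun z _ =>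
      (((hasDerivAt_parabolicIntegral hν z).differentiableAt.const_mul _).mul_const
        _).differentiableWithinAt)
      (isOpen_shiftedSector y)
  have hmem : x + ((T + 1 : ℝ) : ℂ) ∈ shiftedSector y :=
    add_ofReal_mem_shiftedSector hx (by linarith)
  refine hFa.eqOn_of_preconnected_of_frequently_eq hGa (isPreconnected_shiftedSector y) hmem ?_ hx
  -- Points of the ray accumulate at `x + T + 1`; equality at such points is all the identity
  -- theorem needs.
  have hmap : Tendsto (fun τ : ℝ => x + (τ : ℂ)) (𝓝[≠] (T + 1))
      (𝓝[≠] (x + ((T + 1 : ℝ) : ℂ))) := by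
    refine tendsto_nhdsWithin_iff.2 ⟨?_, ?_⟩
    · have hc : Continuous fun τ : ℝ => x + (τ : ℂ) := by fun_prop
      exact (hc.tendsto _).mono_left nhdsWithin_le_nhds
    · filter_upwards [self_mem_nhdsWithin] with τ hτ h
      exact hτ (Complex.ofReal_injective (add_left_cancel h))
  refine hmap.frequently (Eventually.frequently ?_)
  filter_upwards [nhdsWithin_le_nhds (Ioi_mem_nhds (lt_add_one T))] with τ hτ
  exact heq τ (le_of_lt hτ)

/-! ### Branches of the square roots -/

theorem IsRootPair.sq_add_sq {a b x y : ℂ} (h : IsRootPair a b x y) : x ^ 2 + y ^ 2 = 2 * a := by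
  obtain ⟨⟨r, -, hx, hy⟩, -, -⟩ := h
  rw [hx, hy]
  ring

theorem laplaceIntegrand_eq {ν a b x y : ℂ} (h : IsRootPair a b x y) :
    laplaceIntegrand ν a b = fun t => laplaceWeight ν t * laplaceKernel x y t := by
  have h1 := h.sq_add_sq
  ext t
  rw [laplaceIntegrand, laplaceWeight, laplaceKernel, h1, h.2.1, mul_assoc _ (Complex.exp _),
    ← Complex.exp_add]
  ring_nf

theorem re_sq_add_pos {a b r x y : ℂ} (hab : 0 < (a + b).re) (hx : x ^ 2 = a + r)
    (hy : y ^ 2 = a - r) (hxy : x * y = b) : 0 < ((x + y) ^ 2).re := by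
  have h1 : (x + y) ^ 2 = (2 : ℝ) * (a + b) := by
    push_cast
    linear_combination hx + hy + 2 * hxy
  rw [h1, Complex.re_ofReal_mul]
  positivity

theorem IsRootPair.mem_shiftedSector {a b x y : ℂ} (h : IsRootPair a b x y)
    (hab : 0 < (a + b).re) : x ∈ shiftedSector y := by
  refine mem_shiftedSector_iff.2 ⟨h.2.2, ?_⟩
  obtain ⟨⟨r, -, hx, hy⟩, hxy, -⟩ := h
  exact re_sq_add_pos hab hx hy hxy

theorem re_ne_zero_of_re_sq_pos {w : ℂ} (h : 0 < (w ^ 2).re) : w.re ≠ 0 := by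
  intro h0
  rw [sq, Complex.mul_re, h0] at h
  nlinarith [mul_self_nonneg w.im]

/-- Any roots satisfy `xy = ±b`; a sign change of `y` gives `xy = b`. As `(x+y)² = 2(a+b)` has
positive real part, `Re (x+y) ≠ 0`, and changing both signs makes it positive without affecting
`xy`. -/
theorem exists_isRootPair {a b : ℂ} (hab : 0 < (a + b).re) : ∃ x y, IsRootPair a b x y := by
  obtain ⟨r, hr⟩ := IsAlgClosed.exists_pow_nat_eq (a ^ 2 - b ^ 2) two_pos
  obtain ⟨x, hx⟩ := IsAlgClosed.exists_pow_nat_eq (a + r) two_pos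
  obtain ⟨y, hy, hxy⟩ : ∃ y, y ^ 2 = a - r ∧ x * y = b := by
    obtain ⟨y, hy⟩ := IsAlgClosed.exists_pow_nat_eq (a - r) two_pos
    have h : (x * y) ^ 2 = b ^ 2 := by
      rw [mul_pow, hx, hy]
      linear_combination -hr
    rcases sq_eq_sq_iff_eq_or_eq_neg.1 h with h | h
    · exact ⟨y, hy, h⟩
    · exact ⟨-y, by rw [neg_sq, hy], by rw [mul_neg, h, neg_neg]⟩
  rcases (re_ne_zero_of_re_sq_pos (re_sq_add_pos hab hx hy hxy)).lt_or_gt with h | h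
  · refine ⟨-x, -y, ⟨r, hr, by rw [neg_sq, hx], by rw [neg_sq, hy]⟩,
      by rw [neg_mul_neg, hxy], ?_⟩
    rw [← neg_add, Complex.neg_re]
    exact neg_pos.2 h
  · exact ⟨x, y, ⟨r, hr, hx, hy⟩, hxy, h⟩

theorem principalSqrt_sq (z : ℂ) : principalSqrt z ^ 2 = z := by
  rw [principalSqrt, ← Complex.cpow_nat_mul]
  norm_num

theorem principalSqrt_re_nonneg (z : ℂ) : 0 ≤ (principalSqrt z).re := by
  rcases eq_or_ne z 0 with rfl | hz
  · simp [principalSqrt]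
  · rw [principalSqrt, Complex.cpow_def_of_ne_zero hz, Complex.exp_re]
    refine mul_nonneg (Real.exp_pos _).le (Real.cos_nonneg_of_neg_pi_div_two_le_of_le ?_ ?_)
    all_goals
      have him : (Complex.log z * (1 / 2)).im = z.arg / 2 := by
        rw [show (1 / 2 : ℂ) = ((1 / 2 : ℝ) : ℂ) by push_cast; rfl, Complex.im_mul_ofReal,
          Complex.log_im]
        ring
      rw [him]
      linarith [Complex.neg_pi_lt_arg z, Complex.arg_le_pi z]

/-- The point is to exclude `xy = -b` for `b > 0`. With `Re x, Re y ≥ 0` it forces both roots to be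
purely imaginary, and then `2 Re (a+b) = -(Im x - Im y)² ≤ 0`. -/
theorem isRootPair_principalSqrt {a b : ℂ} (hab : 0 < (a + b).re) (hb : 0 ≤ b.re)
    (hb' : b.im = 0) :
    IsRootPair a b (principalSqrt (a + principalSqrt (a ^ 2 - b ^ 2)))
      (principalSqrt (a - principalSqrt (a ^ 2 - b ^ 2))) := by
  have hr := principalSqrt_sq (a ^ 2 - b ^ 2)
  generalize principalSqrt (a ^ 2 - b ^ 2) = r at hr ⊢
  have hx := principalSqrt_sq (a + r)
  have hy := principalSqrt_sq (a - r)
  have hx0 := principalSqrt_re_nonneg (a + r)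
  have hy0 := principalSqrt_re_nonneg (a - r)
  generalize principalSqrt (a + r) = x at *
  generalize principalSqrt (a - r) = y at *
  have hsq : (x * y) ^ 2 = b ^ 2 := by
    rw [mul_pow, hx, hy]
    linear_combination -hr
  have hxy : x * y = b := by
    rcases sq_eq_sq_iff_eq_or_eq_neg.1 hsq with h | h
    · exact h
    have hre := congrArg Complex.re h
    have him := congrArg Complex.im h
    rw [Complex.mul_re, Complex.neg_re] at hre
    rw [Complex.mul_im, Complex.neg_im, hb', neg_zero] at him
    rcases hb.eq_or_lt with hb0 | hb0
    · have : b = 0 := Complex.ext hb0.symm hb'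
      rw [h, this, neg_zero]
    exfalso
    have ha : (x ^ 2 + y ^ 2).re = 2 * a.re := by
      rw [hx, hy, ← Complex.re_ofReal_mul]
      congr 1
      push_cast
      ring
    have hxr : x.re = 0 := by
      by_contra hne
      have hpos : 0 < x.re := lt_of_le_of_ne hx0 (Ne.symm hne)
      -- Real part of `xy = -b` multiplied by the conjugate of `x`.
      have e : (x.re ^ 2 + x.im ^ 2) * y.re = -(b.re * x.re) := by
        linear_combination x.re * hre + x.im * him
      have e1 : 0 ≤ (x.re ^ 2 + x.im ^ 2) * y.re := by positivity
      linarith [mul_pos hb0 hpos]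
    have hyr : y.re = 0 := by
      by_contra hne
      have hpos : 0 < y.re := lt_of_le_of_ne hy0 (Ne.symm hne)
      have e : (y.re ^ 2 + y.im ^ 2) * x.re = -(b.re * y.re) := by
        linear_combination y.re * hre + y.im * him
      have e1 : 0 ≤ (y.re ^ 2 + y.im ^ 2) * x.re := by positivity
      linarith [mul_pos hb0 hpos]
    rw [hxr, hyr] at hre
    rw [sq, sq, Complex.add_re, Complex.mul_re, Complex.mul_re, hxr, hyr] at ha
    rw [Complex.add_re] at hab
    nlinarith [sq_nonneg (x.im - y.im)]
  have hne := re_ne_zero_of_re_sq_pos (re_sq_add_pos hab hx hy hxy)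
  refine ⟨⟨r, hr, hx, hy⟩, hxy, lt_of_le_of_ne ?_ hne.symm⟩
  rw [Complex.add_re]
  exact add_nonneg hx0 hy0

/-! ### Assembly -/

theorem IsRootPair.integral_laplaceIntegrand {ν a b x y : ℂ} (hν : 0 < ν.re)
    (hab : 0 < (a + b).re) (h : IsRootPair a b x y) :
    ∫ t in Set.Ioi (0 : ℝ), laplaceIntegrand ν a b t =
      2 * Complex.exp (a / 2) * Complex.Gamma ν *
        parabolicCylinderD (-ν) x * parabolicCylinderD (-ν) y := by
  have hΓ := Complex.Gamma_ne_zero_of_re_pos hν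
  have hx := Gamma_mul_parabolicCylinderD_neg hν x
  have hy := Gamma_mul_parabolicCylinderD_neg hν y
  have key := Gamma_mul_weightedLaplace hν (h.mem_shiftedSector hab)
  rw [laplaceIntegrand_eq h]
  refine mul_left_cancel₀ hΓ (key.trans ?_)
  -- The Gaussian factors of the two cylinder functions cancel `e^(a/2)` because `x² + y² = 2a`.
  have hexp : Complex.exp (a / 2) * (Complex.exp (-x ^ 2 / 4) * Complex.exp (-y ^ 2 / 4)) = 1 := by
    rw [← Complex.exp_add, ← Complex.exp_add, Complex.exp_eq_one_iff]
    refine ⟨0, ?_⟩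
    linear_combination (-1 / 4) * h.sq_add_sq
  calc 2 * parabolicIntegral ν x * parabolicIntegral ν y
      = 2 * (Complex.exp (a / 2) * (Complex.exp (-x ^ 2 / 4) * Complex.exp (-y ^ 2 / 4))) *
          parabolicIntegral ν x * parabolicIntegral ν y := by rw [hexp, mul_one]
    _ = 2 * Complex.exp (a / 2) * (Complex.exp (-x ^ 2 / 4) * parabolicIntegral ν x) *
          (Complex.exp (-y ^ 2 / 4) * parabolicIntegral ν y) := by ring
    _ = _ := by rw [← hx, ← hy]; ring

theorem mainTheorem2 (ν a b : ℂ) (hν : 0 < ν.re) (hab : 0 < (a + b).re) :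
    MeasureTheory.IntegrableOn (laplaceIntegrand ν a b) (Set.Ioi 0) ∧
    (∃ x y : ℂ, IsRootPair a b x y) ∧
    (∀ x y : ℂ, IsRootPair a b x y →
      ∫ t in Set.Ioi (0 : ℝ), laplaceIntegrand ν a b t =
        2 * Complex.exp (a / 2) * Complex.Gamma ν *
          parabolicCylinderD (-ν) x * parabolicCylinderD (-ν) y) ∧
    (0 ≤ b.re → b.im = 0 →
      ∫ t in Set.Ioi (0 : ℝ), laplaceIntegrand ν a b t =
        2 * Complex.exp (a / 2) * Complex.Gamma ν *
          parabolicCylinderD (-ν) (principalSqrt (a + principalSqrt (a ^ 2 - b ^ 2))) *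
          parabolicCylinderD (-ν) (principalSqrt (a - principalSqrt (a ^ 2 - b ^ 2)))) := by
  obtain ⟨x, y, h⟩ := exists_isRootPair hab
  refine ⟨?_, ⟨x, y, h⟩, fun x y h => h.integral_laplaceIntegrand hν hab, fun hb hb' =>
    (isRootPair_principalSqrt hab hb hb').integral_laplaceIntegrand hν hab⟩
  rw [laplaceIntegrand_eq h]
  exact (isTemperedWeight_laplaceWeight hν).integrableOn_mul_laplaceKernel
    (mem_shiftedSector_iff.1 (h.mem_shiftedSector hab)).2
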